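/- **Conventions.** A nondeterministic Streett word automaton (NSW) $A=(\Sigma,Q,Q_0,\delta,\mathcal T)$ has a finite alphabet $\Sigma$, a finite set of states $Q=\{q_1,\dots,q_N\}$, initial states $Q_0\subseteq Q$, a transition map $\delta:Q\times\Sigma\to 2^Q$ (extended to sets by unions) and a table $\mathcal T=\{(E_1,F_1),\dots,(E_k,F_k)\}$ of $k$ distinct pairs of subsets of $Q$; the infinity set $X$ of a run is accepting iff for all $j$, $X\cap F_j\ne\emptyset$ implies $X\cap E_j\neq\emptyset$. All trees below are finite, rooted and ordered, and their nodes carry names (positive integers) and state labels (subsets of $Q$). **The Safra–Schwoon construction** (a deterministic Rabin automaton, DRW). Let $H=\{1,\dots,k\}$. In a tree, the leaves carry state labels, $\lambda(v)$ is the union of the labels of the leaves below $v$ (the label of $v$ itself if $v$ is a leaf), and each edge is annotated with an element of $H\cup\{0\}$. The initial state is the one-node tree with name $1$ and label $Q_0$. On a letter $\sigma$, replace each leaf label $S$ by $\delta(S,\sigma)$ and call $R(\mathrm{root},H)$, where $R(v,J)$ is the following. (1) If $v$ is a leaf and $J=\emptyset$, return. (2) If $v$ is a leaf and $J\ne\emptyset$,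 move its label to a new child, with edge annotation $\max J$. (3) Let $v_1,\dots,v_l$ be the children of $v$, with edge annotations $j_1,\dots,j_l$. Call $R(v_i,J\setminus\{j_i\})$ for $i=1,\dots,l$. Then for each $i$ with $j_i\neq0$ and each $q\in\lambda(v_i)$: if $q\in F_{j_i}$, remove $q$ from the subtree at $v_i$ and create a new rightmost child of $v$ with label $\{q\}$ and annotation $j_i$; if $q\in E_{j_i}$, create a new rightmost child of $v$ with label $\{q\}$ and annotation the largest element of $J$ below $j_i$, or $0$ if there is none. (4) A state that occurs in the subtrees of several children of $v$ is kept only in the one with the smallest annotation, and among those with equal annotation in the leftmost one. (5) Delete all proper descendants $u$ of $v$ with $\lambda(u)=\emptyset$. (6) If all edges from $v$ to its children are now annotated $0$, then $v$ succeeds: delete its descendants and make it a leaf with label $\lambda(v)$. The name of a new node is any element of $V=\{1,\dots,2N(k+1)\}$ that is unused, i.e. occurs neither in the old tree nor among the nodes created before in the same transition, by any fixed rule that chooses it from the set of names used so far. For each $i\in V$ there is a Rabin pair (trees without a node named $i$, trees with a leaf named $i$), where the first set has to be visited finitely often and the second infinitely often. **Piterman's construction** (a deterministic parity automaton, DPW).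 Same trees and procedure, but a new node gets the smallest name larger than all names used so far, and a state is a tree with two integers $e,f\in\{1,\dots,m+1\}$, where $m=N(k+1)$; initially $e=f=m+1$. After $R(\mathrm{root},H)$, with $Z$ the set of nodes removed in the transition, each surviving node's name is lowered by the number of nodes in $Z$ with a smaller name; $e$ is the minimum of $m+1$ and the (old) names of the nodes in $Z$; $f$ is the minimum of $m+1$ and the (new) names of the surviving nodes that succeeded in the transition. The parity sets are $F_0=\{f=1,e>1\}$, $F_{2i+1}=\{e=i+2,f\ge e\}$ for $0\le i<m$ and $F_{2i+2}=\{f=i+2,e>f\}$ for $0\le i<m-1$; a run is accepting iff the least index of a set visited infinitely often is even. **The uniform construction** (a DPW), for any automaton whose acceptance condition is a predicate $P$ on the infinity sets of runs; for an NSW, $P$ is its Streett condition. A state is a tree whose nodes $v$ carry a name, a state label $\lambda(v)\subseteq Q$ and a hope set $h(v)\subseteq\{1,\dots,N\}$, together with $e,f\in\{1,\dots,m+1\}$, where $m=N^2+N+1$. The annotation of the edge from $v$ to a child $v'$ is $\max((h(v)\cup\{0\})\setminus h(v'))$. The initial state is the one-node tree with name $1$, label $Q_0$ and hope set $\{1,\dots,N\}$,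 with $e=f=m+1$. On a letter $\sigma$, replace each state label $S$ by $\delta(S,\sigma)$ and call $G(\mathrm{root})$, where $G(v)$ is the following. (1) If $v$ is a leaf and $h(v)=\emptyset$, return. (2) If $v$ is a leaf and $h(v)\ne\emptyset$, create a child with label $\lambda(v)$ and hope set $h(v)\setminus\{\max h(v)\}$. (3) Let $v_1,\dots,v_l$ be the children of $v$ in the order of their names, with edge annotations $j_1,\dots,j_l$. Call $G(v_1),\dots,G(v_l)$. Then for each $i$ and each $q\in\lambda(v_i)$: if $j_i\ne0$ and $q=q_{j_i}$, create a new child of $v$ with label $\{q\}$ and hope set $h(v)\setminus\{j'\}$, where $j'$ is the largest element of $h(v)$ below $j_i$, or hope set $h(v)$ if there is none; otherwise, if the index of $q$ is not in $h(v_i)$, remove $q$ from the labels in the subtree at $v_i$. (4) A state that occurs in the labels of several children of $v$ is kept only in the subtree of the one with the smallest edge annotation, and among those with equal annotation of the one with the smallest name. (5) Delete all proper descendants of $v$ with empty label, with their subtrees. (6) If all children of $v$ now have hope set $h(v)$, delete all descendants of $v$; if moreover $P(\{q_i: i\in h(v)\})$ holds, $v$ is marked as successful. The naming, the compaction of names,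 $e$, $f$ and the parity sets are as in Piterman's construction, with the present $m$. In all the constructions the states $q$ in a label are processed in increasing order of their indices. **Theorem.** There are a family $(A_n)_{n\ge0}$ of NSW, where $A_n$ has $3n+1$ states and $2^n+1$ pairs, real constants $c,C>0$ and $n_0\in\mathbb N$ such that for all $n\ge n_0$: 1. the Safra–Schwoon construction, for every rule of choosing unused names, turns $A_n$ into a DRW whose set of reachable states is finite and has at least $2^{c n^3}$ elements; 2. Piterman's construction turns $A_n$ into a DPW whose set of reachable states is finite and has at least $2^{c n^3}$ elements; 3. the uniform construction turns $A_n$ into a DPW whose set of reachable states is finite and has at most $2^{C n^2\log n}$ elements. -/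

import Mathlib

namespace OmegaDet

/-! ## Automata -/

/-- A nondeterministic Streett word automaton over the alphabet `α` with the `N` states
`Fin N` and a table of `k` pairs `(E j, F j)`: the infinity set `X` of a run is accepting
iff for every `j`, `X` meets `E j` whenever it meets `F j`. -/
structure NSW (α : Type) (N k : ℕ) where
  init : Finset (Fin N)
  δ : Fin N → α → Finset (Fin N)
  E : Fin k → Finset (Fin N)
  F : Fin k → Finset (Fin N)

/-- A nondeterministic word automaton with states `Fin N` whose acceptance condition is an
arbitrary predicate `acc` on the infinity set of a run. -/
structure OmegaAut (α : Type) (N : ℕ) where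
  init : Finset (Fin N)
  δ : Fin N → α → Finset (Fin N)
  acc : Finset (Fin N) → Bool

/-- The Streett condition as a predicate on infinity sets. -/
def NSW.toOmegaAut {α : Type} {N k : ℕ} (A : NSW α N k) : OmegaAut α N where
  init := A.init
  δ := A.δ
  acc := fun X => decide (∀ j, (X ∩ A.F j).Nonempty → (X ∩ A.E j).Nonempty)

/-- A deterministic Rabin word automaton with `numPairs` pairs: the infinity set `X` of a
run is accepting iff for some `i`, `X` avoids `E i` and meets `F i`. -/
structure DRW (α S : Type) where
  init : S
  step : S → α → S
  numPairs : ℕ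
  E : Fin numPairs → Set S
  F : Fin numPairs → Set S

/-- A deterministic parity word automaton with `numSets` parity sets: the infinity set of a
run is accepting iff the least `i` for which it meets `F i` exists and is even. -/
structure DPW (α S : Type) where
  init : S
  step : S → α → S
  numSets : ℕ
  F : Fin numSets → Set S

/-- The states of a deterministic automaton that are reachable from its initial state. -/
def DRW.reachable {α S : Type} (D : DRW α S) : Set S :=
  {s | ∃ w : List α, w.foldl D.step D.init = s}

/-- The states of a deterministic automaton that are reachable from its initial state. -/
def DPW.reachable {α S : Type} (D : DPW α S) : Set S :=
  {s | ∃ w : List α, w.foldl D.step D.init = s}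

/-! ## Trees -/

/-- Finite rooted ordered trees. Every node carries a name, a decoration of type `β` and
a set of automaton states (its state label). -/
inductive STree (N : ℕ) (β : Type) where
  | node (name : ℕ) (deco : β) (label : Finset (Fin N)) (children : List (STree N β)) :
      STree N β

namespace STree

variable {N : ℕ} {β : Type}

def deco : STree N β → β
  | node _ d _ _ => d

def label : STree N β → Finset (Fin N)
  | node _ _ S _ => S

mutual
/-- The names of all nodes of a tree. -/
def names : STree N β → Finset ℕ
  | node a _ _ cs => insert a (namesList cs)

def namesList : List (STree N β) → Finset ℕ
  | [] => ∅
  | c :: cs => names c ∪ namesList cs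
end

mutual
/-- The names of all leaves of a tree. -/
def leafNames : STree N β → Finset ℕ
  | node a _ _ [] => {a}
  | node _ _ _ (c :: cs) => leafNames c ∪ leafNamesList cs

def leafNamesList : List (STree N β) → Finset ℕ
  | [] => ∅
  | c :: cs => leafNames c ∪ leafNamesList cs
end

mutual
/-- The union of the state labels of the leaves of a tree. -/
def leafStates : STree N β → Finset (Fin N)
  | node _ _ S [] => S
  | node _ _ _ (c :: cs) => leafStates c ∪ leafStatesList cs

def leafStatesList : List (STree N β) → Finset (Fin N)
  | [] => ∅
  | c :: cs => leafStates c ∪ leafStatesList cs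
end

mutual
/-- Apply `f` to the name and `g` to the state label of every node. -/
def mapNodes (f : ℕ → ℕ) (g : Finset (Fin N) → Finset (Fin N)) : STree N β → STree N β
  | node a d S cs => node (f a) d (g S) (mapNodesList f g cs)

def mapNodesList (f : ℕ → ℕ) (g : Finset (Fin N) → Finset (Fin N)) :
    List (STree N β) → List (STree N β)
  | [] => []
  | c :: cs => mapNodes f g c :: mapNodesList f g cs
end

/-- Remove the states in `R` from all state labels. -/
def remove (R : Finset (Fin N)) (t : STree N β) : STree N β :=
  t.mapNodes id (· \ R)

/-- Replace every state label by its set of successors under the letter `σ`. -/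
def advance {α : Type} (δ : Fin N → α → Finset (Fin N)) (σ : α) (t : STree N β) :
    STree N β :=
  t.mapNodes id (fun S => S.biUnion (fun q => δ q σ))

mutual
/-- Delete every proper descendant `u` with `lam u = ∅`, with the whole subtree at `u`. -/
def prune (lam : STree N β → Finset (Fin N)) : STree N β → STree N β
  | node a d S cs => node a d S (pruneList lam cs)

def pruneList (lam : STree N β → Finset (Fin N)) : List (STree N β) → List (STree N β)
  | [] => []
  | c :: cs => if lam c = ∅ then pruneList lam cs else prune lam c :: pruneList lam cs
end

/-- Make the sets `lam c` of the siblings `cs` disjoint: a state that occurs in several of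
them is kept only in the one with the smallest edge annotation `ann c`, and among those
with the same annotation in the leftmost one. -/
def separate {k : ℕ} (ann : STree N β → WithBot (Fin k)) (lam : STree N β → Finset (Fin N))
    (cs : List (STree N β)) : List (STree N β) :=
  cs.zipIdx.map fun x =>
    x.1.remove (((cs.zipIdx.filter fun y =>
      decide (ann y.1 < ann x.1 ∨ (ann y.1 = ann x.1 ∧ y.2 < x.2))).map
        fun y => lam y.1).foldr (· ∪ ·) ∅)

/-- Create one new leaf for every entry `(d, S)` of the list, with decoration `d` and state
label `S`. The names are chosen one after the other by `fresh`, which is given the set of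
the names used so far; the updated set of used names is returned as well. -/
def spawn (fresh : Finset ℕ → ℕ) :
    Finset ℕ → List (β × Finset (Fin N)) → List (STree N β) × Finset ℕ
  | used, [] => ([], used)
  | used, (d, S) :: l =>
    let r := spawn fresh (insert (fresh used) used) l
    (node (fresh used) d S [] :: r.1, r.2)

end STree

/-- The bookkeeping during one transition: `used` holds the names of all nodes of the old
tree and of all nodes created so far (deleted or not), `succ` the names of the nodes that
have succeeded and were reset. -/
structure Log where
  used : Finset ℕ
  succ : Finset ℕ

/-- The smallest name larger than all names used so far. -/
def nextName (used : Finset ℕ) : ℕ := used.sup id + 1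

/-- A tree with the two integer components `e` and `f`. -/
structure MarkedTree (N : ℕ) (β : Type) where
  tree : STree N β
  e : ℕ
  f : ℕ

/-- The last stage of a transition. The recursive transformation has produced `t` and the
log `L`, and the nodes with names in `Z` have been removed. Names are compacted, `e` becomes
the smallest removed name, `f` the smallest (new) name of a surviving successful node; both
are `m + 1` if there is no smaller value. -/
def compact {N : ℕ} {β : Type} (m : ℕ) (t : STree N β) (L : Log) : MarkedTree N β :=
  let Z := L.used \ t.names
  let rename : ℕ → ℕ := fun a => a - (Z.filter (· < a)).card
  { tree := t.mapNodes rename id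
    e := Z.fold min (m + 1) id
    f := (L.succ ∩ t.names).fold min (m + 1) rename }

/-- The `2 m` parity sets: `F 0 = {f = 1, e > 1}`, `F (2 i + 1) = {e = i + 2, f ≥ e}` and
`F (2 i + 2) = {f = i + 2, e > f}`. As `e, f ≤ m + 1` always holds, the last set is
`F (2 m - 1) = {e, f > m}`. -/
def paritySet {N : ℕ} {β : Type} (m : ℕ) (j : Fin (2 * m)) : Set (MarkedTree N β) :=
  if j.val % 2 = 1 then {t | t.e = j.val / 2 + 2 ∧ t.e ≤ t.f}
  else {t | t.f = j.val / 2 + 1 ∧ t.f < t.e}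

/-! ## The constructions of Safra–Schwoon and Piterman for Streett automata

The trees are `(Q, H)`-trees. The decoration of a node is the annotation of the edge from
its parent: `⊥` stands for the annotation `0`, and `j : Fin k` for the pair of index `j`
(the root is decorated with `⊥`). Only leaves have a nonempty state label, and `λ(v)` is
`leafStates v`. -/

/-- `(Q, H)`-trees, with `N` states and `k` pairs. -/
abbrev QHTree (N k : ℕ) := STree N (WithBot (Fin k))

/-- `J \ {a}`, where `J \ {⊥} = J`. -/
def dropAnn {k : ℕ} (J : Finset (Fin k)) (a : WithBot (Fin k)) : Finset (Fin k) :=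
  J.filter fun j : Fin k => (j : WithBot (Fin k)) ≠ a

/-- The largest element of `J` below `a`, and `⊥` if there is none. -/
def predAnn {k : ℕ} (J : Finset (Fin k)) (a : WithBot (Fin k)) : WithBot (Fin k) :=
  (J.filter fun j : Fin k => (j : WithBot (Fin k)) < a).max

/-- The set `T j` if the annotation `a` is `j`, and the empty set if `a = ⊥`. -/
def annSet {N k : ℕ} (T : Fin k → Finset (Fin N)) : WithBot (Fin k) → Finset (Fin N)
  | none => ∅
  | some j => T j

namespace Safra

open STree

variable {α : Type} {N k : ℕ}

/-- The children to be created on account of the child `c`: for every `q ∈ λ(c)`, where `c`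
has annotation `a`, one with annotation `a` if `q ∈ F a`, and one with the next
smaller annotation if `q ∈ E a`. -/
def newChildren (A : NSW α N k) (J : Finset (Fin k)) (c : QHTree N k) :
    List (WithBot (Fin k) × Finset (Fin N)) :=
  (c.leafStates.sort (· ≤ ·)).flatMap fun q : Fin N =>
    (if q ∈ annSet A.F c.deco then [(c.deco, {q})] else []) ++
    (if q ∈ annSet A.E c.deco then [(predAnn J c.deco, {q})] else [])

/-- What the recursive procedure does at the non-leaf node with name `a`, decoration `d`
and witness set `J`, after it has been called on all children and has returned `cs`. -/
def finish (A : NSW α N k) (fresh : Finset ℕ → ℕ) (J : Finset (Fin k)) (a : ℕ)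
    (d : WithBot (Fin k)) (cs : List (QHTree N k)) (L : Log) : QHTree N k × Log :=
  let new := spawn fresh L.used (cs.flatMap (newChildren A J))
  let cs₁ := cs.map (fun c => c.remove (annSet A.F c.deco)) ++ new.1
  let cs₂ := pruneList leafStates (separate deco leafStates cs₁)
  if ∀ c ∈ cs₂, c.deco = ⊥ then
    (node a d (leafStatesList cs₂) [], ⟨new.2, insert a L.succ⟩)
  else
    (node a d ∅ cs₂, ⟨new.2, L.succ⟩)

/-- The recursive procedure at a leaf with name `a`, decoration `d`, state label `S` and
witness set `J`. The first argument is a recursion bound, to be called with `J.card`. -/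
def recLeaf (A : NSW α N k) (fresh : Finset ℕ → ℕ) :
    ℕ → Finset (Fin k) → ℕ → WithBot (Fin k) → Finset (Fin N) → Log → QHTree N k × Log
  | 0, _, a, d, S, L => (node a d S [], L)
  | b + 1, J, a, d, S, L =>
    let r := recLeaf A fresh b (dropAnn J J.max) (fresh L.used) J.max S
      ⟨insert (fresh L.used) L.used, L.succ⟩
    finish A fresh J a d [r.1] r.2

mutual
/-- The recursive procedure on a tree whose root has the witness set `J`. -/
def recTree (A : NSW α N k) (fresh : Finset ℕ → ℕ) :
    QHTree N k → Finset (Fin k) → Log → QHTree N k × Log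
  | node a d S [], J, L => recLeaf A fresh J.card J a d S L
  | node a d _ (c :: cs), J, L =>
    let r := recTree A fresh c (dropAnn J c.deco) L
    let rs := recList A fresh cs J r.2
    finish A fresh J a d (r.1 :: rs.1) rs.2

/-- The recursive procedure on siblings, from left to right; `J` belongs to their parent. -/
def recList (A : NSW α N k) (fresh : Finset ℕ → ℕ) :
    List (QHTree N k) → Finset (Fin k) → Log → List (QHTree N k) × Log
  | [], _, L => ([], L)
  | c :: cs, J, L =>
    let r := recTree A fresh c (dropAnn J c.deco) L
    let rs := recList A fresh cs J r.2
    (r.1 :: rs.1, rs.2)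
end

/-- The transformation of the tree `t` on reading the letter `σ`, with the log. -/
def next (A : NSW α N k) (fresh : Finset ℕ → ℕ) (t : QHTree N k) (σ : α) :
    QHTree N k × Log :=
  recTree A fresh (t.advance A.δ σ) Finset.univ ⟨t.names, ∅⟩

/-- The tree that consists of the root only. -/
def initTree (A : NSW α N k) : QHTree N k := node 1 ⊥ A.init []

/-- A way of choosing unused names from `V = {1, …, 2 · |Q| · (|H| + 1)}`. -/
structure Naming (N k : ℕ) where
  pick : Finset ℕ → ℕ
  pick_mem : ∀ used, pick used ∈ Finset.Icc 1 (2 * N * (k + 1))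
  pick_unused : ∀ used, ¬ Finset.Icc 1 (2 * N * (k + 1)) ⊆ used → pick used ∉ used

/-- The deterministic Rabin automaton of the Safra–Schwoon construction. For each name
`i ∈ V` (`i = j + 1`) there is a pair: no node is named `i`; a leaf is named `i`. -/
def drw (A : NSW α N k) (V : Naming N k) : DRW α (QHTree N k) where
  init := initTree A
  step := fun t σ => (next A V.pick t σ).1
  numPairs := 2 * N * (k + 1)
  E := fun j => {t | j.val + 1 ∉ t.names}
  F := fun j => {t | j.val + 1 ∈ t.leafNames}

end Safra

/-- The deterministic parity automaton of Piterman's construction: the same transformation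
of trees, with increasing names, name compaction and the components `e` and `f`. -/
def pitermanDPW {α : Type} {N k : ℕ} (A : NSW α N k) :
    DPW α (MarkedTree N (WithBot (Fin k))) where
  init := ⟨Safra.initTree A, N * (k + 1) + 1, N * (k + 1) + 1⟩
  step := fun t σ =>
    let r := Safra.next A nextName t.tree σ
    compact (N * (k + 1)) r.1 r.2
  numSets := 2 * (N * (k + 1))
  F := paritySet (N * (k + 1))

/-! ## The uniform construction

The trees are compact generalized Safra trees. The decoration of a node is its hope set, and
every node has a state label. The edge from `v` to its child `v'` has the annotation
`max (h(v) \ h(v'))`, which is `⊥` (for `0`) if `h(v) = h(v')`. Siblings are listed in the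
order of their names: a new node is the last one and has the largest name. -/

/-- Compact generalized Safra trees, without the components `e` and `f`. -/
abbrev HopeTree (N : ℕ) := STree N (Finset (Fin N))

namespace Uniform

open STree

variable {α : Type} {N : ℕ}

/-- The annotation of the edge from a node with hope set `h` to its child `c`. -/
def edgeAnn (h : Finset (Fin N)) (c : HopeTree N) : WithBot (Fin N) := (h \ c.deco).max

/-- The children to be created on account of the child `c` of a node with hope set `h`: one
if the state that annotates the edge to `c` belongs to the state label of `c`. -/
def newChildren (h : Finset (Fin N)) (c : HopeTree N) :
    List (Finset (Fin N) × Finset (Fin N)) :=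
  (c.label.sort (· ≤ ·)).flatMap fun q : Fin N =>
    if (q : WithBot (Fin N)) = edgeAnn h c then
      [(dropAnn h (predAnn h (edgeAnn h c)), {q})] else []

/-- The states that are removed from the child `c` of a node with hope set `h` since they
are neither in the hope set of `c` nor the annotation of the edge to `c`. -/
def outside (h : Finset (Fin N)) (c : HopeTree N) : Finset (Fin N) :=
  c.label.filter fun q : Fin N => (q : WithBot (Fin N)) ≠ edgeAnn h c ∧ q ∉ c.deco

/-- What the recursive procedure does at the non-leaf node with name `a`, hope set `h`
and state label `S`, after it has been called on all children and has returned `cs`. -/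
def finish (A : OmegaAut α N) (a : ℕ) (h : Finset (Fin N)) (S : Finset (Fin N))
    (cs : List (HopeTree N)) (L : Log) : HopeTree N × Log :=
  let new := spawn nextName L.used (cs.flatMap (newChildren h))
  let cs₁ := cs.map (fun c => c.remove (outside h c)) ++ new.1
  let cs₂ := pruneList label (separate (edgeAnn h) label cs₁)
  if ∀ c ∈ cs₂, c.deco = h then
    (node a h S [], ⟨new.2, if A.acc h then insert a L.succ else L.succ⟩)
  else
    (node a h S cs₂, ⟨new.2, L.succ⟩)

/-- The recursive procedure at a leaf with name `a`, hope set `h` and state label `S`. The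
first argument is a recursion bound, to be called with `h.card`. -/
def recLeaf (A : OmegaAut α N) :
    ℕ → ℕ → Finset (Fin N) → Finset (Fin N) → Log → HopeTree N × Log
  | 0, a, h, S, L => (node a h S [], L)
  | b + 1, a, h, S, L =>
    let r := recLeaf A b (nextName L.used) (dropAnn h h.max) S
      ⟨insert (nextName L.used) L.used, L.succ⟩
    finish A a h S [r.1] r.2

mutual
/-- The recursive procedure on a tree. -/
def recTree (A : OmegaAut α N) : HopeTree N → Log → HopeTree N × Log
  | node a h S [], L => recLeaf A h.card a h S L
  | node a h S (c :: cs), L =>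
    let r := recTree A c L
    let rs := recList A cs r.2
    finish A a h S (r.1 :: rs.1) rs.2

/-- The recursive procedure on siblings, in the order of their names. -/
def recList (A : OmegaAut α N) : List (HopeTree N) → Log → List (HopeTree N) × Log
  | [], L => ([], L)
  | c :: cs, L =>
    let r := recTree A c L
    let rs := recList A cs r.2
    (r.1 :: rs.1, rs.2)
end

end Uniform

/-- The deterministic parity automaton of the uniform construction. -/
def uniformDPW {α : Type} {N : ℕ} (A : OmegaAut α N) :
    DPW α (MarkedTree N (Finset (Fin N))) where
  init := ⟨STree.node 1 Finset.univ A.init [], N ^ 2 + N + 2, N ^ 2 + N + 2⟩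
  step := fun t σ =>
    let r := Uniform.recTree A (t.tree.advance A.δ σ) ⟨t.tree.names, ∅⟩
    compact (N ^ 2 + N + 1) r.1 r.2
  numSets := 2 * (N ^ 2 + N + 1)
  F := paritySet (N ^ 2 + N + 1)

end OmegaDet

-- Lower bound. Take all transition maps as letters, so that every permutation of the states is a
-- letter. Under a permutation the labels of siblings stay disjoint, and the path from the root to
-- the leaf that holds a state evolves by itself: an annotation `j` whose set `E j` does not contain
-- the state is kept, and the first annotation whose set `E j` contains it is lowered by one, which
-- cuts off everything below. Paths therefore work as counters. There are `n` storage states, which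
-- lie in no set of the table and whose paths are only prolonged, and `n` counter states `s l`,
-- where `s l ∈ E j` iff `j` is at least the threshold `1 + l * w`, with `w = 2 ^ (n / 2)`. A
-- transposition moves a storage state's place in the tree to `s 0`; repeating the letter counts the
-- topmost annotation down to any value between the first two thresholds. Handing over to `s 1`
-- leaves that value alone, since it lies below the threshold of `s 1`, and counts down at the next
-- level, and so on. After `n` levels the place is handed back to the storage state. The storage
-- states can be served one after another (`exists_paths`), so every `n × n` matrix with entries
-- below `w` is written into a reachable tree. A tree determines the paths (`At.unique`), so there
-- are at least `w ^ (n * n)` reachable trees (`pow_le_ncard`). Enough annotations are available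
-- because `n * 2 ^ (n / 2) < 2 ^ n`. The argument never looks at names, so it serves both
-- constructions for Streett automata. The sets `F j` only make the pairs distinct. Upper bound. A
-- tree of the uniform construction has depth at most `2 N`: an edge with nonzero annotation costs
-- an element of the hope set, an edge annotated `0` costs a state of the label (`settle_depth_le`).
-- Siblings have disjoint nonempty labels, so there are at most `1 + 2 N ^ 2` nodes
-- (`STree.size_le`). A hope set is known from the edge annotations above it, and a label from its
-- states that lie in no child, so the tree is described by a bracket word of length `O(N ^ 2)` over
-- an alphabet of polynomial size (`card_stateTree_le`). With `N = 3 n + 1` this gives `2 ^ O(n ^ 2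
-- log n)` trees, and the components `e`, `f` contribute a polynomial factor. The same depth
-- potential, with the witness set in place of the hope set, makes the other two constructions
-- finite.

namespace OmegaDet

-- Labelled trees: elementary operations, size, names and the separation of siblings

namespace STree

variable {N k : ℕ} {β : Type}

theorem induct {P : STree N β → Prop}
    (h : ∀ a d S cs, (∀ c ∈ cs, P c) → P (node a d S cs)) (t : STree N β) : P t := by
  refine STree.rec (motive_1 := P) (motive_2 := fun cs => ∀ c ∈ cs, P c) ?_ ?_ ?_ t
  · intro a d S cs ih
    exact h a d S cs ih
  · simp
  · intro c cs hc hcs x hx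
    rcases List.mem_cons.1 hx with rfl | hx
    · exact hc
    · exact hcs x hx

theorem mem_namesList {cs : List (STree N β)} {x : ℕ} :
    x ∈ namesList cs ↔ ∃ c ∈ cs, x ∈ names c := by
  induction cs <;> simp_all [namesList]

theorem mem_leafStatesList {cs : List (STree N β)} {q : Fin N} :
    q ∈ leafStatesList cs ↔ ∃ c ∈ cs, q ∈ leafStates c := by
  induction cs <;> simp_all [leafStatesList]

theorem leafStates_node {a : ℕ} {d : β} {S : Finset (Fin N)} {cs : List (STree N β)}
    (h : cs ≠ []) : leafStates (node a d S cs) = leafStatesList cs := by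
  cases cs with
  | nil => exact absurd rfl h
  | cons c cs => simp [leafStates, leafStatesList]

theorem mapNodesList_eq (f : ℕ → ℕ) (g : Finset (Fin N) → Finset (Fin N))
    (cs : List (STree N β)) : mapNodesList f g cs = cs.map (mapNodes f g) := by
  induction cs <;> simp_all [mapNodesList]

theorem pruneList_eq (lam : STree N β → Finset (Fin N)) (cs : List (STree N β)) :
    pruneList lam cs = (cs.filter fun c => lam c ≠ ∅).map (prune lam) := by
  induction cs with
  | nil => simp [pruneList]
  | cons c cs ih =>
    by_cases h : lam c = ∅ <;> simp [pruneList, ih, h]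

@[simp] theorem mapNodes_node (f : ℕ → ℕ) (g : Finset (Fin N) → Finset (Fin N)) (a : ℕ) (d : β)
    (S : Finset (Fin N)) (cs : List (STree N β)) :
    mapNodes f g (node a d S cs) = node (f a) d (g S) (cs.map (mapNodes f g)) := by
  simp [mapNodes, mapNodesList_eq]

@[simp] theorem prune_node (lam : STree N β → Finset (Fin N)) (a : ℕ) (d : β)
    (S : Finset (Fin N)) (cs : List (STree N β)) :
    prune lam (node a d S cs) =
      node a d S ((cs.filter fun c => lam c ≠ ∅).map (prune lam)) := by
  simp [prune, pruneList_eq]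

@[simp] theorem deco_mapNodes (f : ℕ → ℕ) (g : Finset (Fin N) → Finset (Fin N))
    (t : STree N β) : (mapNodes f g t).deco = t.deco := by
  cases t; simp [deco]

@[simp] theorem label_mapNodes (f : ℕ → ℕ) (g : Finset (Fin N) → Finset (Fin N))
    (t : STree N β) : (mapNodes f g t).label = g t.label := by
  cases t; simp [label]

@[simp] theorem deco_remove (R : Finset (Fin N)) (t : STree N β) :
    (t.remove R).deco = t.deco := by
  simp [remove]

@[simp] theorem label_remove (R : Finset (Fin N)) (t : STree N β) :
    (t.remove R).label = t.label \ R := by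
  simp [remove]

@[simp] theorem deco_prune (lam : STree N β → Finset (Fin N)) (t : STree N β) :
    (prune lam t).deco = t.deco := by
  cases t; simp [deco]

@[simp] theorem label_prune (lam : STree N β → Finset (Fin N)) (t : STree N β) :
    (prune lam t).label = t.label := by
  cases t; simp [label]

theorem leafStates_mapNodes (f : ℕ → ℕ) (g : Finset (Fin N) → Finset (Fin N))
    (hu : ∀ S T, g (S ∪ T) = g S ∪ g T) (h0 : g ∅ = ∅) (t : STree N β) :
    leafStates (mapNodes f g t) = g (leafStates t) := by
  induction t using induct with
  | h a d S cs ih =>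
    have hl : ∀ l : List (STree N β), (∀ c ∈ l, leafStates (mapNodes f g c) = g (leafStates c)) →
        leafStatesList (l.map (mapNodes f g)) = g (leafStatesList l) := by
      intro l hl
      induction l with
      | nil => simp [leafStatesList, h0]
      | cons c l ihl =>
        simp only [List.map_cons, leafStatesList, hu]
        rw [hl c (by simp), ihl fun x hx => hl x (by simp [hx])]
    by_cases h : cs = []
    · subst h; simp [leafStates]
    · rw [mapNodes_node, leafStates_node (by simpa using h), leafStates_node h, hl cs ih]

@[simp] theorem leafStates_remove (R : Finset (Fin N)) (t : STree N β) :
    (t.remove R).leafStates = t.leafStates \ R :=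
  leafStates_mapNodes _ _ (fun S T => Finset.union_sdiff_distrib S T R) (by simp) t

/-- Nonemptiness matters: a node that loses all its children becomes a leaf, and its own label,
ignored before, would then count. -/
theorem leafStates_prune (t : STree N β) (h : t.leafStates ≠ ∅) :
    (prune leafStates t).leafStates = t.leafStates := by
  induction t using induct with
  | h a d S cs ih =>
    by_cases hcs : cs = []
    · subst hcs; simp [leafStates]
    · rw [leafStates_node hcs] at h ⊢
      obtain ⟨q, hq⟩ := Finset.nonempty_iff_ne_empty.2 h
      obtain ⟨c, hc, hqc⟩ := mem_leafStatesList.1 hq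
      have hne : ((cs.filter fun c => leafStates c ≠ ∅).map (prune leafStates)) ≠ [] := by
        refine List.ne_nil_of_mem (a := prune leafStates c) (List.mem_map_of_mem ?_)
        simp only [List.mem_filter, hc, true_and, decide_eq_true_eq]
        exact Finset.ne_empty_of_mem hqc
      rw [prune_node, leafStates_node hne]
      ext x
      simp only [mem_leafStatesList, List.mem_map, List.mem_filter, decide_eq_true_eq]
      constructor
      · rintro ⟨_, ⟨c, ⟨hc, hn⟩, rfl⟩, hx⟩
        exact ⟨c, hc, by rwa [ih c hc hn] at hx⟩
      · rintro ⟨c, hc, hx⟩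
        have hn := Finset.ne_empty_of_mem hx
        exact ⟨_, ⟨c, ⟨hc, hn⟩, rfl⟩, by rwa [ih c hc hn]⟩

/-- What the arguments about siblings need of the sets attached to the nodes. -/
structure IsLabelling (lam : STree N β → Finset (Fin N)) : Prop where
  remove : ∀ R t, lam (t.remove R) = lam t \ R
  prune : ∀ t, lam t ≠ ∅ → lam (prune lam t) = lam t

theorem isLabelling_leafStates : IsLabelling (leafStates : STree N β → Finset (Fin N)) :=
  ⟨leafStates_remove, leafStates_prune⟩

theorem isLabelling_label : IsLabelling (label : STree N β → Finset (Fin N)) :=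
  ⟨label_remove, fun t _ => label_prune label t⟩

/-! ### Separated and reduced trees -/

/-- The sets attached to siblings are disjoint. -/
inductive Separated (lam : STree N β → Finset (Fin N)) : STree N β → Prop
  | node (a : ℕ) (d : β) (S : Finset (Fin N)) (cs : List (STree N β))
      (hc : ∀ c ∈ cs, Separated lam c)
      (hd : cs.Pairwise fun c c' => Disjoint (lam c) (lam c')) : Separated lam (node a d S cs)

theorem separated_node {lam : STree N β → Finset (Fin N)} {a : ℕ} {d : β} {S : Finset (Fin N)}
    {cs : List (STree N β)} :
    Separated lam (node a d S cs) ↔ (∀ c ∈ cs, Separated lam c) ∧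
      cs.Pairwise fun c c' => Disjoint (lam c) (lam c') :=
  ⟨fun h => by cases h with | node _ _ _ _ hc hd => exact ⟨hc, hd⟩, fun h => .node _ _ _ _ h.1 h.2⟩

/-- The sets attached to the proper descendants of the root are nonempty. -/
inductive Reduced (lam : STree N β → Finset (Fin N)) : STree N β → Prop
  | node (a : ℕ) (d : β) (S : Finset (Fin N)) (cs : List (STree N β))
      (hc : ∀ c ∈ cs, Reduced lam c) (hn : ∀ c ∈ cs, lam c ≠ ∅) : Reduced lam (node a d S cs)

theorem reduced_node {lam : STree N β → Finset (Fin N)} {a : ℕ} {d : β} {S : Finset (Fin N)}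
    {cs : List (STree N β)} :
    Reduced lam (node a d S cs) ↔ (∀ c ∈ cs, Reduced lam c) ∧ ∀ c ∈ cs, lam c ≠ ∅ :=
  ⟨fun h => by cases h with | node _ _ _ _ hc hd => exact ⟨hc, hd⟩, fun h => .node _ _ _ _ h.1 h.2⟩

theorem Separated.mapNodes {lam : STree N β → Finset (Fin N)} (f : ℕ → ℕ)
    (g : Finset (Fin N) → Finset (Fin N)) (hl : ∀ t, lam (mapNodes f g t) = g (lam t))
    (hg : ∀ S T, Disjoint S T → Disjoint (g S) (g T)) {t : STree N β}
    (h : Separated lam t) : Separated lam (mapNodes f g t) := by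
  induction t using induct with
  | h a d S cs ih =>
    rw [separated_node] at h
    rw [mapNodes_node, separated_node]
    constructor
    · simp only [List.mem_map, forall_exists_index, and_imp, forall_apply_eq_imp_iff₂]
      exact fun c hc => ih c hc (h.1 c hc)
    · rw [List.pairwise_map]
      refine h.2.imp fun hd => ?_
      rw [hl, hl]
      exact hg _ _ hd

theorem Separated.remove {lam : STree N β → Finset (Fin N)} (hlam : IsLabelling lam)
    (R : Finset (Fin N)) {t : STree N β} (h : Separated lam t) :
    Separated lam (t.remove R) :=
  h.mapNodes _ _ (fun t => hlam.remove R t)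
    (fun _ _ hd => hd.mono Finset.sdiff_subset Finset.sdiff_subset)

theorem Separated.prune {lam : STree N β → Finset (Fin N)} (hlam : IsLabelling lam)
    {t : STree N β} (h : Separated lam t) : Separated lam (prune lam t) := by
  induction t using induct with
  | h a d S cs ih =>
    rw [separated_node] at h
    rw [prune_node, separated_node]
    constructor
    · simp only [List.mem_map, List.mem_filter]
      rintro _ ⟨c, ⟨hc, -⟩, rfl⟩
      exact ih c hc (h.1 c hc)
    · rw [List.pairwise_map]
      refine List.Pairwise.imp_of_mem ?_ (h.2.filter _)
      intro c c' hc hc' hd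
      simp only [List.mem_filter, decide_eq_true_eq] at hc hc'
      rwa [hlam.prune _ hc.2, hlam.prune _ hc'.2]

theorem reduced_prune {lam : STree N β → Finset (Fin N)} (hlam : IsLabelling lam)
    (t : STree N β) : Reduced lam (prune lam t) := by
  induction t using induct with
  | h a d S cs ih =>
    rw [prune_node, reduced_node]
    simp only [List.mem_map, List.mem_filter, decide_eq_true_eq]
    constructor
    · rintro _ ⟨c, ⟨hc, -⟩, rfl⟩
      exact ih c hc
    · rintro _ ⟨c, ⟨-, hn⟩, rfl⟩
      rwa [hlam.prune _ hn]

/-! ### Depth and size -/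

mutual
/-- The length of a longest path from the root to a leaf. -/
def depth : STree N β → ℕ
  | node _ _ _ cs => depthList cs

def depthList : List (STree N β) → ℕ
  | [] => 0
  | c :: cs => max (depth c + 1) (depthList cs)
end

mutual
/-- The number of nodes. -/
def size : STree N β → ℕ
  | node _ _ _ cs => 1 + sizeList cs

def sizeList : List (STree N β) → ℕ
  | [] => 0
  | c :: cs => size c + sizeList cs
end

theorem depthList_le {cs : List (STree N β)} {D : ℕ} :
    depthList cs ≤ D ↔ ∀ c ∈ cs, depth c + 1 ≤ D := by
  induction cs <;> simp_all [depthList]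

theorem depth_node_le {a : ℕ} {d : β} {S : Finset (Fin N)} {cs : List (STree N β)} {D : ℕ} :
    depth (node a d S cs) ≤ D ↔ ∀ c ∈ cs, depth c + 1 ≤ D := by
  rw [depth, depthList_le]

theorem depth_lt_of_mem {a : ℕ} {d : β} {S : Finset (Fin N)} {cs : List (STree N β)}
    {c : STree N β} (h : c ∈ cs) : depth c + 1 ≤ depth (node a d S cs) :=
  depth_node_le.1 le_rfl c h

theorem depth_mapNodes_le (f : ℕ → ℕ) (g : Finset (Fin N) → Finset (Fin N)) (t : STree N β) :
    depth (mapNodes f g t) ≤ depth t := by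
  induction t using induct with
  | h a d S cs ih =>
    rw [mapNodes_node, depth_node_le]
    simp only [List.mem_map, forall_exists_index, and_imp, forall_apply_eq_imp_iff₂]
    exact fun c hc => (Nat.succ_le_succ (ih c hc)).trans (depth_lt_of_mem hc)

theorem depth_prune_le (lam : STree N β → Finset (Fin N)) (t : STree N β) :
    depth (prune lam t) ≤ depth t := by
  induction t using induct with
  | h a d S cs ih =>
    rw [prune_node, depth_node_le]
    simp only [List.mem_map, List.mem_filter]
    rintro _ ⟨c, ⟨hc, -⟩, rfl⟩
    exact (Nat.succ_le_succ (ih c hc)).trans (depth_lt_of_mem hc)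

theorem sizeList_eq (cs : List (STree N β)) : sizeList cs = (cs.map size).sum := by
  induction cs <;> simp_all [sizeList]

theorem size_mapNodes (f : ℕ → ℕ) (g : Finset (Fin N) → Finset (Fin N)) (t : STree N β) :
    size (mapNodes f g t) = size t := by
  induction t using induct with
  | h a d S cs ih =>
    simp only [mapNodes_node, size, sizeList_eq, List.map_map, Nat.add_left_cancel_iff]
    exact congrArg List.sum (List.map_congr_left ih)

theorem sum_card_le {γ : Type} (f : γ → Finset (Fin N)) (cs : List γ) (S : Finset (Fin N))
    (hd : cs.Pairwise fun c c' => Disjoint (f c) (f c')) (hS : ∀ c ∈ cs, f c ⊆ S) :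
    (cs.map fun c => (f c).card).sum ≤ S.card := by
  induction cs generalizing S with
  | nil => simp
  | cons c cs ih =>
    rw [List.pairwise_cons] at hd
    have h1 := ih (S \ f c) hd.2 (fun x hx => Finset.subset_sdiff.2
      ⟨hS x (by simp [hx]), (hd.1 x hx).symm⟩)
    have h2 := Finset.card_sdiff_add_card_eq_card (hS c (by simp))
    simp only [List.map_cons, List.sum_cons]
    omega

/-- The sets attached to the nodes decrease along the edges. -/
inductive Nested (lam : STree N β → Finset (Fin N)) : STree N β → Prop
  | node (a : ℕ) (d : β) (S : Finset (Fin N)) (cs : List (STree N β))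
      (hc : ∀ c ∈ cs, Nested lam c) (hs : ∀ c ∈ cs, lam c ⊆ lam (node a d S cs)) :
      Nested lam (node a d S cs)

theorem nested_node {lam : STree N β → Finset (Fin N)} {a : ℕ} {d : β} {S : Finset (Fin N)}
    {cs : List (STree N β)} :
    Nested lam (node a d S cs) ↔ (∀ c ∈ cs, Nested lam c) ∧
      ∀ c ∈ cs, lam c ⊆ lam (node a d S cs) :=
  ⟨fun h => by cases h with | node _ _ _ _ hc hd => exact ⟨hc, hd⟩, fun h => .node _ _ _ _ h.1 h.2⟩

theorem nested_leafStates (t : STree N β) : Nested leafStates t := by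
  induction t using induct with
  | h a d S cs ih =>
    refine .node _ _ _ _ ih fun c hc => ?_
    rw [leafStates_node (List.ne_nil_of_mem hc)]
    exact fun q hq => mem_leafStatesList.2 ⟨c, hc, hq⟩

/-- Each of the `D` levels below the root carries disjoint nonempty subsets of `lam t`, hence at
most `(lam t).card` nodes. -/
theorem size_le {lam : STree N β → Finset (Fin N)} {t : STree N β} {D : ℕ}
    (hs : Separated lam t) (hr : Reduced lam t) (hm : Nested lam t) (hD : depth t ≤ D) :
    size t ≤ 1 + (lam t).card * D := by
  induction t using induct generalizing D with
  | h a d S cs ih =>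
    rw [separated_node] at hs
    rw [reduced_node] at hr
    rw [nested_node] at hm
    rw [depth_node_le] at hD
    rw [size, sizeList_eq]
    have h1 : ∀ c ∈ cs, size c ≤ (lam c).card * D := by
      intro c hc
      obtain ⟨D', rfl⟩ : ∃ D', D = D' + 1 := ⟨D - 1, by have := hD c hc; omega⟩
      have h1 := ih c hc (hs.1 c hc) (hr.1 c hc) (hm.1 c hc) (D := D')
        (by have := hD c hc; omega)
      -- A nonempty set pays for the node itself: `1 + s * D' ≤ s * (D' + 1)` as soon as `1 ≤ s`.
      have h2 := Finset.card_pos.2 (Finset.nonempty_iff_ne_empty.2 (hr.2 c hc))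
      rw [mul_add]
      omega
    have h2 := sum_card_le lam cs _ hs.2 hm.2
    have h3 : (cs.map size).sum ≤ (cs.map fun c => (lam c).card * D).sum :=
      List.sum_le_sum h1
    rw [List.sum_map_mul_right] at h3
    exact Nat.add_le_add_left (h3.trans (Nat.mul_le_mul_right D h2)) 1

/-! ### Names -/

theorem names_mapNodes (f : ℕ → ℕ) (g : Finset (Fin N) → Finset (Fin N)) (t : STree N β) :
    names (mapNodes f g t) = (names t).image f := by
  induction t using induct with
  | h a d S cs ih =>
    ext x
    simp only [mapNodes_node, names, Finset.mem_insert, mem_namesList, List.mem_map,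
      Finset.mem_image]
    constructor
    · rintro (rfl | ⟨_, ⟨c, hc, rfl⟩, hx⟩)
      · exact ⟨a, Or.inl rfl, rfl⟩
      · rw [ih c hc, Finset.mem_image] at hx
        obtain ⟨y, hy, rfl⟩ := hx
        exact ⟨y, Or.inr ⟨c, hc, hy⟩, rfl⟩
    · rintro ⟨y, rfl | ⟨c, hc, hy⟩, rfl⟩
      · exact Or.inl rfl
      · exact Or.inr ⟨_, ⟨c, hc, rfl⟩, by rw [ih c hc]; exact Finset.mem_image_of_mem f hy⟩

@[simp] theorem names_remove (R : Finset (Fin N)) (t : STree N β) :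
    (t.remove R).names = t.names := by
  simp [remove, names_mapNodes]

theorem names_prune_subset (lam : STree N β → Finset (Fin N)) (t : STree N β) :
    names (prune lam t) ⊆ names t := by
  induction t using induct with
  | h a d S cs ih =>
    intro x
    simp only [prune_node, names, Finset.mem_insert, mem_namesList, List.mem_map,
      List.mem_filter]
    rintro (rfl | ⟨_, ⟨c, hc, rfl⟩, hx⟩)
    · exact Or.inl rfl
    · exact Or.inr ⟨c, hc.1, ih c hc.1 hx⟩

theorem card_names_le_size (t : STree N β) : (names t).card ≤ size t := by
  induction t using induct with
  | h a d S cs ih =>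
    have hl : ∀ l : List (STree N β), (∀ c ∈ l, (names c).card ≤ size c) →
        (namesList l).card ≤ sizeList l := by
      intro l hl
      induction l with
      | nil => simp [namesList]
      | cons c l ihl =>
        have h1 := ihl fun x hx => hl x (by simp [hx])
        have h2 := hl c (by simp)
        have h3 := Finset.card_union_le (names c) (namesList l)
        simp only [namesList, sizeList]
        omega
    have h1 := hl cs ih
    have h2 := Finset.card_insert_le a (namesList cs)
    simp only [names, size]
    omega

/-! ### Separation of siblings -/

/-- The states that `separate` removes from the sibling `x`. -/
def stolen (ann : STree N β → WithBot (Fin k)) (lam : STree N β → Finset (Fin N))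
    (cs : List (STree N β)) (x : STree N β × ℕ) : Finset (Fin N) :=
  ((cs.zipIdx.filter fun y =>
      decide (ann y.1 < ann x.1 ∨ (ann y.1 = ann x.1 ∧ y.2 < x.2))).map
        fun y => lam y.1).foldr (· ∪ ·) ∅

theorem separate_eq (ann : STree N β → WithBot (Fin k)) (lam : STree N β → Finset (Fin N))
    (cs : List (STree N β)) :
    separate ann lam cs = cs.zipIdx.map fun x => x.1.remove (stolen ann lam cs x) := rfl

theorem mem_stolen {ann : STree N β → WithBot (Fin k)} {lam : STree N β → Finset (Fin N)}
    {cs : List (STree N β)} {x : STree N β × ℕ} {q : Fin N} :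
    q ∈ stolen ann lam cs x ↔ ∃ y ∈ cs.zipIdx,
      (ann y.1 < ann x.1 ∨ (ann y.1 = ann x.1 ∧ y.2 < x.2)) ∧ q ∈ lam y.1 := by
  have h : ∀ l : List (Finset (Fin N)), q ∈ l.foldr (· ∪ ·) ∅ ↔ ∃ S ∈ l, q ∈ S := by
    intro l
    induction l <;> simp_all
  rw [stolen, h]
  simp only [List.mem_map, List.mem_filter, decide_eq_true_eq]
  constructor
  · rintro ⟨_, ⟨y, ⟨hy, hxy⟩, rfl⟩, hq⟩
    exact ⟨y, hy, hxy, hq⟩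
  · rintro ⟨y, hy, hxy, hq⟩
    exact ⟨_, ⟨y, ⟨hy, hxy⟩, rfl⟩, hq⟩

theorem separate_pairwise {ann : STree N β → WithBot (Fin k)} {lam : STree N β → Finset (Fin N)}
    (hlam : IsLabelling lam) (cs : List (STree N β)) :
    (separate ann lam cs).Pairwise fun c c' => Disjoint (lam c) (lam c') := by
  rw [separate_eq, List.pairwise_map, List.pairwise_iff_getElem]
  intro i j hi hj hij
  have hmi : cs.zipIdx[i] ∈ cs.zipIdx := List.getElem_mem hi
  have hmj : cs.zipIdx[j] ∈ cs.zipIdx := List.getElem_mem hj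
  rw [hlam.remove, hlam.remove, Finset.disjoint_left]
  intro q hqi hqj
  rw [Finset.mem_sdiff, mem_stolen] at hqi hqj
  rcases lt_trichotomy (ann cs.zipIdx[i].1) (ann cs.zipIdx[j].1) with h | h | h
  · exact hqj.2 ⟨_, hmi, Or.inl h, hqi.1⟩
  · exact hqj.2 ⟨_, hmi, Or.inr ⟨h, by simpa using hij⟩, hqi.1⟩
  · exact hqi.2 ⟨_, hmj, Or.inl h, hqj.1⟩

/-- The siblings `cs` after separation and deletion of the nodes with empty sets. -/
def settle (ann : STree N β → WithBot (Fin k)) (lam : STree N β → Finset (Fin N))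
    (cs : List (STree N β)) : List (STree N β) :=
  pruneList lam (separate ann lam cs)

theorem settle_pairwise {ann : STree N β → WithBot (Fin k)} {lam : STree N β → Finset (Fin N)}
    (hlam : IsLabelling lam) (cs : List (STree N β)) :
    (settle ann lam cs).Pairwise fun c c' => Disjoint (lam c) (lam c') := by
  rw [settle, pruneList_eq, List.pairwise_map]
  refine List.Pairwise.imp_of_mem ?_ ((separate_pairwise hlam cs).filter _)
  intro c c' hc hc' hd
  simp only [List.mem_filter, decide_eq_true_eq] at hc hc'
  rwa [hlam.prune _ hc.2, hlam.prune _ hc'.2]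

/-- The last clause records who wins the competition for a state: the survivor had the smallest
annotation among all siblings holding it. -/
theorem of_mem_settle {ann : STree N β → WithBot (Fin k)} {lam : STree N β → Finset (Fin N)}
    (hlam : IsLabelling lam) {cs : List (STree N β)} {c' : STree N β}
    (h : c' ∈ settle ann lam cs) :
    ∃ c ∈ cs, ∃ R, c' = prune lam (c.remove R) ∧ lam c' = lam c \ R ∧ lam c \ R ≠ ∅ ∧
      ∀ q ∈ lam c', ∀ x ∈ cs, ann x < ann c → q ∉ lam x := by
  rw [settle, pruneList_eq, List.mem_map] at h
  obtain ⟨_, hc, rfl⟩ := h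
  simp only [separate_eq, List.mem_filter, List.mem_map, decide_eq_true_eq] at hc
  obtain ⟨⟨x, hx, rfl⟩, hn⟩ := hc
  have hn' := hn
  rw [hlam.remove] at hn'
  have he : lam (prune lam (x.1.remove (stolen ann lam cs x))) =
      lam x.1 \ stolen ann lam cs x := by rw [hlam.prune _ hn, hlam.remove]
  refine ⟨x.1, List.fst_mem_of_mem_zipIdx hx, _, rfl, he, hn', ?_⟩
  intro q hq y hy hlt hqy
  rw [he, Finset.mem_sdiff, mem_stolen] at hq
  obtain ⟨i, hi, rfl⟩ := List.getElem_of_mem hy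
  exact hq.2 ⟨(cs[i], i), by simp [List.mk_mem_zipIdx_iff_getElem?], Or.inl hlt, hqy⟩

theorem exists_mem_settle {ann : STree N β → WithBot (Fin k)} {lam : STree N β → Finset (Fin N)}
    (hlam : IsLabelling lam) {cs : List (STree N β)} {c : STree N β} {q : Fin N}
    (hc : c ∈ cs) (hq : q ∈ lam c) :
    ∃ x ∈ cs, ∃ R, prune lam (x.remove R) ∈ settle ann lam cs ∧
      lam (prune lam (x.remove R)) = lam x \ R ∧ q ∈ lam x ∧ q ∉ R ∧ ann x ≤ ann c := by
  classical
  obtain ⟨i, hi, rfl⟩ := List.getElem_of_mem hc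
  -- The winner minimizes annotation and position lexicographically among the siblings that contain
  -- `q`.
  obtain ⟨⟨j, hj⟩, hqj, hmin⟩ := Finset.exists_min_image
    (Finset.univ.filter fun j : Fin cs.length => q ∈ lam cs[j])
    (fun j => toLex (ann cs[j], (j : ℕ))) ⟨⟨i, hi⟩, by simpa using hq⟩
  simp only [Finset.mem_filter, Finset.mem_univ, true_and, Fin.getElem_fin] at hqj hmin
  have hns : q ∉ stolen ann lam cs (cs[j], j) := by
    rw [mem_stolen]
    rintro ⟨⟨y, l⟩, hy, hlt, hqy⟩
    obtain ⟨hl, rfl⟩ := List.getElem?_eq_some_iff.1 (List.mk_mem_zipIdx_iff_getElem?.1 hy)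
    have := hmin ⟨l, hl⟩ hqy
    rw [Prod.Lex.toLex_le_toLex] at this
    simp only at this hlt
    rcases this with h | ⟨h, h'⟩ <;> rcases hlt with g | ⟨g, g'⟩
    · exact lt_asymm h g
    · exact h.ne' g
    · exact g.ne' h
    · omega
  have hm : (cs[j].remove (stolen ann lam cs (cs[j], j))) ∈ separate ann lam cs := by
    rw [separate_eq, List.mem_map]
    exact ⟨(cs[j], j), by simp [List.mk_mem_zipIdx_iff_getElem?], rfl⟩
  have hn : lam (cs[j].remove (stolen ann lam cs (cs[j], j))) ≠ ∅ := by
    rw [hlam.remove]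
    exact Finset.ne_empty_of_mem (Finset.mem_sdiff.2 ⟨hqj, hns⟩)
  refine ⟨cs[j], List.getElem_mem hj, stolen ann lam cs (cs[j], j), ?_, ?_, hqj, hns, ?_⟩
  · rw [settle, pruneList_eq, List.mem_map]
    exact ⟨_, List.mem_filter.2 ⟨hm, by simpa using hn⟩, rfl⟩
  · rw [hlam.prune _ hn, hlam.remove]
  · have := hmin ⟨i, hi⟩ hq
    rw [Prod.Lex.toLex_le_toLex] at this
    rcases this with h | h
    · exact h.le
    · exact h.1.le

theorem mem_settle_iff {ann : STree N β → WithBot (Fin k)} {lam : STree N β → Finset (Fin N)}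
    (hlam : IsLabelling lam) {cs : List (STree N β)} {q : Fin N} :
    (∃ c ∈ settle ann lam cs, q ∈ lam c) ↔ ∃ c ∈ cs, q ∈ lam c := by
  constructor
  · rintro ⟨c', hc', hq⟩
    obtain ⟨c, hc, R, -, he, -⟩ := of_mem_settle hlam hc'
    exact ⟨c, hc, (Finset.mem_sdiff.1 (he ▸ hq)).1⟩
  · rintro ⟨c, hc, hq⟩
    obtain ⟨x, -, R, hm, he, hx, hR, -⟩ := exists_mem_settle hlam (ann := ann) hc hq
    exact ⟨_, hm, he ▸ Finset.mem_sdiff.2 ⟨hx, hR⟩⟩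

/-- The annotation `⊥` is the smallest, so a child annotated `⊥` wins every state it shares. If a
child with another annotation survives, any state left in it was therefore missing from each child
annotated `⊥`; `hbot` turns such a missing state into a better depth bound. If no such child
survives, the node is reset to a leaf and no bound is needed. -/
theorem settle_depth_le {ann : STree N β → WithBot (Fin k)} {lam : STree N β → Finset (Fin N)}
    (hlam : IsLabelling lam) (hr : ∀ R t, ann (remove R t) = ann t)
    (hp : ∀ t, ann (prune lam t) = ann t) {cs : List (STree N β)} {D : ℕ}
    (hD : ∀ c ∈ cs, ann c ≠ ⊥ → depth c + 1 ≤ D)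
    (hbot : ∀ c ∈ cs, ann c = ⊥ → ∀ w ∈ cs, ann w ≠ ⊥ → ∀ q ∈ lam w, q ∉ lam c →
      depth c + 1 ≤ D)
    (h : ∃ c ∈ settle ann lam cs, ann c ≠ ⊥) : ∀ c ∈ settle ann lam cs, depth c + 1 ≤ D := by
  intro c hc
  obtain ⟨x, hx, R, rfl, -⟩ := of_mem_settle hlam hc
  have h1 : depth (prune lam (x.remove R)) ≤ depth x :=
    (depth_prune_le _ _).trans (depth_mapNodes_le _ _ _)
  suffices depth x + 1 ≤ D by omega
  by_cases hxb : ann x = ⊥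
  · obtain ⟨w', hw', hwb⟩ := h
    obtain ⟨w, hw, R', rfl, he, hne, hmin⟩ := of_mem_settle hlam hw'
    rw [hp, hr] at hwb
    obtain ⟨q, hq⟩ := Finset.nonempty_iff_ne_empty.2 hne
    exact hbot x hx hxb w hw hwb q (Finset.mem_sdiff.1 hq).1
      (hmin q (he ▸ hq) x hx (hxb ▸ bot_lt_iff_ne_bot.2 hwb))
  · exact hD x hx hxb

theorem settle_separated {ann : STree N β → WithBot (Fin k)} {lam : STree N β → Finset (Fin N)}
    (hlam : IsLabelling lam) {cs : List (STree N β)} (h : ∀ c ∈ cs, Separated lam c) :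
    ∀ c ∈ settle ann lam cs, Separated lam c := by
  intro c hc
  obtain ⟨x, hx, R, rfl, -⟩ := of_mem_settle hlam hc
  exact ((h x hx).remove hlam R).prune hlam

theorem settle_reduced {ann : STree N β → WithBot (Fin k)} {lam : STree N β → Finset (Fin N)}
    (hlam : IsLabelling lam) (cs : List (STree N β)) :
    ∀ c ∈ settle ann lam cs, Reduced lam c ∧ lam c ≠ ∅ := by
  intro c hc
  obtain ⟨x, hx, R, rfl, he, hne, -⟩ := of_mem_settle hlam hc
  exact ⟨reduced_prune hlam _, he ▸ hne⟩

/-! ### Creation of new nodes -/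

/-- `used'` results from `used` by choosing finitely many new names. -/
inductive Extends (fresh : Finset ℕ → ℕ) (used : Finset ℕ) : Finset ℕ → Prop
  | refl : Extends fresh used used
  | step {used' : Finset ℕ} (h : Extends fresh used used') :
      Extends fresh used (insert (fresh used') used')

theorem Extends.trans {fresh : Finset ℕ → ℕ} {u v w : Finset ℕ} (h : Extends fresh u v)
    (h' : Extends fresh v w) : Extends fresh u w := by
  induction h' with
  | refl => exact h
  | step _ ih => exact .step ih

theorem Extends.subset {fresh : Finset ℕ → ℕ} {u v : Finset ℕ} (h : Extends fresh u v) :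
    u ⊆ v := by
  induction h with
  | refl => exact subset_rfl
  | step _ ih => exact ih.trans (Finset.subset_insert _ _)

theorem Extends.subset_union {fresh : Finset ℕ → ℕ} {u v X : Finset ℕ} (h : Extends fresh u v)
    (hX : ∀ u, fresh u ∈ X) : v ⊆ u ∪ X := by
  induction h with
  | refl => exact Finset.subset_union_left
  | step _ ih => exact Finset.insert_subset (Finset.mem_union_right _ (hX _)) ih

theorem nextName_Icc (M : ℕ) : nextName (Finset.Icc 1 M) = M + 1 := by
  refine congrArg (· + 1) (le_antisymm (Finset.sup_le fun x hx => (Finset.mem_Icc.1 hx).2) ?_)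
  rcases Nat.eq_zero_or_pos M with rfl | h
  · exact Nat.zero_le _
  · exact Finset.le_sup (f := id) (Finset.mem_Icc.2 ⟨h, le_rfl⟩)

/-- Choosing the next larger name keeps the used names an initial segment; compaction of names
relies on this. -/
theorem Extends.exists_Icc {M : ℕ} {v : Finset ℕ} (h : Extends nextName (Finset.Icc 1 M) v) :
    ∃ M', v = Finset.Icc 1 M' := by
  induction h with
  | refl => exact ⟨M, rfl⟩
  | step _ ih =>
    obtain ⟨M', rfl⟩ := ih
    refine ⟨M' + 1, ?_⟩
    rw [nextName_Icc]
    ext x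
    simp only [Finset.mem_insert, Finset.mem_Icc]
    omega

theorem spawn_extends (fresh : Finset ℕ → ℕ) (l : List (β × Finset (Fin N))) (used : Finset ℕ) :
    Extends fresh used (spawn fresh used l).2 := by
  induction l generalizing used with
  | nil => exact .refl
  | cons x l ih => exact (Extends.step .refl).trans (ih _)

theorem names_spawn_subset (fresh : Finset ℕ → ℕ) (l : List (β × Finset (Fin N)))
    (used : Finset ℕ) : ∀ c ∈ (spawn fresh used l).1, names c ⊆ (spawn fresh used l).2 := by
  induction l generalizing used with
  | nil => simp [spawn]
  | cons x l ih =>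
    simp only [spawn, List.mem_cons, forall_eq_or_imp]
    refine ⟨?_, ih _⟩
    simp only [names, namesList, insert_empty_eq, Finset.singleton_subset_iff]
    exact (spawn_extends fresh l _).subset (Finset.mem_insert_self _ _)

theorem of_mem_spawn {fresh : Finset ℕ → ℕ} {l : List (β × Finset (Fin N))} {used : Finset ℕ}
    {c : STree N β} (h : c ∈ (spawn fresh used l).1) : ∃ a, ∃ x ∈ l, c = node a x.1 x.2 [] := by
  induction l generalizing used with
  | nil => simp [spawn] at h
  | cons x l ih =>
    simp only [spawn, List.mem_cons] at h
    rcases h with rfl | h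
    · exact ⟨_, x, by simp, rfl⟩
    · obtain ⟨a, y, hy, rfl⟩ := ih h
      exact ⟨a, y, by simp [hy], rfl⟩

theorem exists_mem_spawn (fresh : Finset ℕ → ℕ) {l : List (β × Finset (Fin N))}
    (used : Finset ℕ) {x : β × Finset (Fin N)} (h : x ∈ l) :
    ∃ a, node a x.1 x.2 [] ∈ (spawn fresh used l).1 := by
  induction l generalizing used with
  | nil => simp at h
  | cons y l ih =>
    simp only [spawn, List.mem_cons]
    rcases List.mem_cons.1 h with rfl | h
    · exact ⟨_, Or.inl rfl⟩
    · obtain ⟨a, ha⟩ := ih (insert (fresh used) used) h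
      exact ⟨a, Or.inr ha⟩

theorem namesList_settle_subset {ann : STree N β → WithBot (Fin k)}
    {lam : STree N β → Finset (Fin N)} (hlam : IsLabelling lam) {cs : List (STree N β)}
    {used : Finset ℕ} (h : ∀ c ∈ cs, names c ⊆ used) :
    namesList (settle ann lam cs) ⊆ used := by
  intro x hx
  obtain ⟨c, hc, hxc⟩ := mem_namesList.1 hx
  obtain ⟨y, hy, R, rfl, -⟩ := of_mem_settle hlam hc
  have := names_prune_subset _ _ hxc
  rw [names_remove] at this
  exact h y hy this

end STree
end OmegaDet

-- The Streett constructions: shape of the trees produced by one transition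

namespace OmegaDet

section

variable {N k : ℕ}

theorem mem_dropAnn {J : Finset (Fin k)} {a : WithBot (Fin k)} {j : Fin k} :
    j ∈ dropAnn J a ↔ j ∈ J ∧ (j : WithBot (Fin k)) ≠ a := by
  simp [dropAnn]

@[simp] theorem dropAnn_bot (J : Finset (Fin k)) : dropAnn J ⊥ = J := by
  ext j; simp [mem_dropAnn]

@[simp] theorem dropAnn_coe (J : Finset (Fin k)) (j : Fin k) : dropAnn J j = J.erase j := by
  ext i
  simp [mem_dropAnn, and_comm]

theorem predAnn_eq_bot_or (J : Finset (Fin k)) (a : WithBot (Fin k)) :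
    predAnn J a = ⊥ ∨ ∃ j ∈ J, predAnn J a = j := by
  rcases h : predAnn J a with _ | j
  · exact Or.inl rfl
  · exact Or.inr ⟨j, (Finset.mem_filter.1 (Finset.mem_of_max h)).1, rfl⟩

theorem predAnn_lt {J : Finset (Fin k)} {a : WithBot (Fin k)} {j : Fin k}
    (h : predAnn J a = j) : (j : WithBot (Fin k)) < a :=
  (Finset.mem_filter.1 (Finset.mem_of_max h)).2

@[simp] theorem annSet_bot (T : Fin k → Finset (Fin N)) : annSet T ⊥ = ∅ := rfl

@[simp] theorem annSet_coe (T : Fin k → Finset (Fin N)) (j : Fin k) : annSet T j = T j := rfl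

end

namespace Safra

open STree

variable {α : Type} {N k : ℕ}

/-- The annotations of the edges from a node belong to its witness set or are `⊥`. -/
inductive Annotated : Finset (Fin k) → QHTree N k → Prop
  | node (J : Finset (Fin k)) (a : ℕ) (d : WithBot (Fin k)) (S : Finset (Fin N))
      (cs : List (QHTree N k)) (hd : ∀ c ∈ cs, c.deco = ⊥ ∨ ∃ j ∈ J, c.deco = j)
      (hc : ∀ c ∈ cs, Annotated (dropAnn J c.deco) c) : Annotated J (node a d S cs)

theorem annotated_node {J : Finset (Fin k)} {a : ℕ} {d : WithBot (Fin k)} {S : Finset (Fin N)}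
    {cs : List (QHTree N k)} : Annotated J (node a d S cs) ↔
      (∀ c ∈ cs, c.deco = ⊥ ∨ ∃ j ∈ J, c.deco = j) ∧
        ∀ c ∈ cs, Annotated (dropAnn J c.deco) c :=
  ⟨fun h => by cases h with | node _ _ _ _ _ hd hc => exact ⟨hd, hc⟩,
    fun h => .node _ _ _ _ _ h.1 h.2⟩

theorem Annotated.mapNodes (f : ℕ → ℕ) (g : Finset (Fin N) → Finset (Fin N))
    {J : Finset (Fin k)} {t : QHTree N k} (h : Annotated J t) :
    Annotated J (mapNodes f g t) := by
  induction t using induct generalizing J with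
  | h a d S cs ih =>
    rw [annotated_node] at h
    rw [mapNodes_node, annotated_node]
    simp only [List.mem_map, forall_exists_index, and_imp, forall_apply_eq_imp_iff₂,
      deco_mapNodes]
    exact ⟨h.1, fun c hc => ih c hc (h.2 c hc)⟩

theorem Annotated.prune (lam : QHTree N k → Finset (Fin N)) {J : Finset (Fin k)}
    {t : QHTree N k} (h : Annotated J t) : Annotated J (prune lam t) := by
  induction t using induct generalizing J with
  | h a d S cs ih =>
    rw [annotated_node] at h
    rw [prune_node, annotated_node]
    simp only [List.mem_map, List.mem_filter]
    constructor
    · rintro _ ⟨c, ⟨hc, -⟩, rfl⟩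
      rw [deco_prune]
      exact h.1 c hc
    · rintro _ ⟨c, ⟨hc, -⟩, rfl⟩
      rw [deco_prune]
      exact ih c hc (h.2 c hc)

theorem mem_newChildren {A : NSW α N k} {J : Finset (Fin k)} {c : QHTree N k}
    {x : WithBot (Fin k) × Finset (Fin N)} :
    x ∈ newChildren A J c ↔ ∃ q ∈ c.leafStates,
      (q ∈ annSet A.F c.deco ∧ x = (c.deco, {q})) ∨
      (q ∈ annSet A.E c.deco ∧ x = (predAnn J c.deco, {q})) := by
  simp only [newChildren, List.mem_flatMap, Finset.mem_sort, List.mem_append]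
  refine exists_congr fun q => and_congr_right fun _ => or_congr ?_ ?_ <;> split_ifs <;> simp_all

/-- The children of a node before separation. -/
def pieces (A : NSW α N k) (fresh : Finset ℕ → ℕ) (J : Finset (Fin k))
    (cs : List (QHTree N k)) (L : Log) : List (QHTree N k) :=
  cs.map (fun c => c.remove (annSet A.F c.deco)) ++
    (spawn fresh L.used (cs.flatMap (newChildren A J))).1

/-- The children of a node after separation. -/
def settled (A : NSW α N k) (fresh : Finset ℕ → ℕ) (J : Finset (Fin k))
    (cs : List (QHTree N k)) (L : Log) : List (QHTree N k) :=
  settle deco leafStates (pieces A fresh J cs L)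

theorem of_mem_pieces {A : NSW α N k} {fresh : Finset ℕ → ℕ} {J : Finset (Fin k)}
    {cs : List (QHTree N k)} {L : Log} {c : QHTree N k} (h : c ∈ pieces A fresh J cs L) :
    (∃ x ∈ cs, c = x.remove (annSet A.F x.deco)) ∨
    (∃ x ∈ cs, ∃ q ∈ x.leafStates, ∃ a, q ∈ annSet A.F x.deco ∧ c = node a x.deco {q} []) ∨
    ∃ x ∈ cs, ∃ q ∈ x.leafStates, ∃ a, q ∈ annSet A.E x.deco ∧
      c = node a (predAnn J x.deco) {q} [] := by
  rcases List.mem_append.1 h with h | h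
  · obtain ⟨x, hx, rfl⟩ := List.mem_map.1 h
    exact Or.inl ⟨x, hx, rfl⟩
  · obtain ⟨a, y, hy, rfl⟩ := of_mem_spawn h
    obtain ⟨x, hx, hy⟩ := List.mem_flatMap.1 hy
    obtain ⟨q, hq, ⟨hT, rfl⟩ | ⟨hT, rfl⟩⟩ := mem_newChildren.1 hy
    · exact Or.inr (Or.inl ⟨x, hx, q, hq, a, hT, rfl⟩)
    · exact Or.inr (Or.inr ⟨x, hx, q, hq, a, hT, rfl⟩)

theorem finish_fst (A : NSW α N k) (fresh : Finset ℕ → ℕ) (J : Finset (Fin k)) (a : ℕ)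
    (d : WithBot (Fin k)) (cs : List (QHTree N k)) (L : Log) :
    (finish A fresh J a d cs L).1 =
      if ∀ c ∈ settled A fresh J cs L, c.deco = ⊥ then
        node a d (leafStatesList (settled A fresh J cs L)) []
      else node a d ∅ (settled A fresh J cs L) := by
  simp only [finish]
  change (if ∀ c ∈ settled A fresh J cs L, c.deco = ⊥ then _ else _ : QHTree N k × Log).1 = _
  split_ifs <;> rfl

/-- No state is lost: one removed because of `F` comes back in a new child, and separation discards
only duplicates. -/
theorem leafStatesList_settled (A : NSW α N k) (fresh : Finset ℕ → ℕ) (J : Finset (Fin k))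
    (cs : List (QHTree N k)) (L : Log) :
    leafStatesList (settled A fresh J cs L) = leafStatesList cs := by
  ext q
  rw [mem_leafStatesList, settled, mem_settle_iff isLabelling_leafStates, mem_leafStatesList]
  constructor
  · rintro ⟨c, hc, hq⟩
    rcases of_mem_pieces hc with ⟨x, hx, rfl⟩ | ⟨x, hx, p, hp, a, -, rfl⟩ |
      ⟨x, hx, p, hp, a, -, rfl⟩
    · rw [leafStates_remove, Finset.mem_sdiff] at hq
      exact ⟨x, hx, hq.1⟩
    all_goals
      simp only [leafStates, Finset.mem_singleton] at hq
      exact ⟨x, hx, hq ▸ hp⟩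
  · rintro ⟨c, hc, hq⟩
    by_cases hF : q ∈ annSet A.F c.deco
    · obtain ⟨a, ha⟩ := exists_mem_spawn fresh L.used (List.mem_flatMap.2
        ⟨c, hc, mem_newChildren.2 ⟨q, hq, Or.inl ⟨hF, rfl⟩⟩⟩)
      exact ⟨_, List.mem_append_right _ ha, by simp [leafStates]⟩
    · exact ⟨_, List.mem_append_left _ (List.mem_map_of_mem hc), by simp [hq, hF]⟩

theorem leafStates_finish (A : NSW α N k) (fresh : Finset ℕ → ℕ) (J : Finset (Fin k)) (a : ℕ)
    (d : WithBot (Fin k)) (cs : List (QHTree N k)) (L : Log) :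
    (finish A fresh J a d cs L).1.leafStates = leafStatesList cs := by
  rw [finish_fst, ← leafStatesList_settled A fresh J cs L]
  split_ifs with h
  · rfl
  · refine leafStates_node fun h0 => h ?_
    rw [h0]
    simp

theorem deco_finish (A : NSW α N k) (fresh : Finset ℕ → ℕ) (J : Finset (Fin k)) (a : ℕ)
    (d : WithBot (Fin k)) (cs : List (QHTree N k)) (L : Log) :
    (finish A fresh J a d cs L).1.deco = d := by
  rw [finish_fst]
  split_ifs <;> rfl

/-- The properties of the trees that the recursive procedure returns. -/
structure Settled (J : Finset (Fin k)) (t : QHTree N k) : Prop where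
  annotated : Annotated J t
  separated : Separated leafStates t
  reduced : Reduced leafStates t
  depth_le : depth t ≤ t.leafStates.card + J.card

theorem settled_leaf (J : Finset (Fin k)) (a : ℕ) (d : WithBot (Fin k)) (S : Finset (Fin N)) :
    Settled J (node a d S [] : QHTree N k) := by
  refine ⟨?_, ?_, ?_, ?_⟩
  · simp [annotated_node]
  · simp [separated_node]
  · simp [reduced_node]
  · simp [depth, depthList]

/-- The depth is controlled by the potential `|λ| + |J|`. Passing to a child with annotation `j`
removes `j` from `J`; passing to a child annotated `⊥` keeps `J` but loses a state, by
`settle_depth_le`. -/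
theorem settled_finish (A : NSW α N k) (fresh : Finset ℕ → ℕ) (J : Finset (Fin k)) (a : ℕ)
    (d : WithBot (Fin k)) (cs : List (QHTree N k)) (L : Log)
    (hd : ∀ c ∈ cs, c.deco = ⊥ ∨ ∃ j ∈ J, c.deco = j)
    (hc : ∀ c ∈ cs, Settled (dropAnn J c.deco) c) :
    Settled J (finish A fresh J a d cs L).1 := by
  have hl := leafStates_finish A fresh J a d cs L
  have hsub : ∀ c ∈ cs, c.leafStates ⊆ leafStatesList cs := fun c hc q hq =>
    mem_leafStatesList.2 ⟨c, hc, hq⟩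
  rw [finish_fst] at hl ⊢
  split_ifs at hl ⊢ with h
  · exact settled_leaf _ _ _ _
  push Not at h
  refine ⟨annotated_node.2 ?_, separated_node.2 ⟨?_, settle_pairwise isLabelling_leafStates _⟩,
    reduced_node.2 ?_, ?_⟩
  · have hp : ∀ c ∈ pieces A fresh J cs L, (c.deco = ⊥ ∨ ∃ j ∈ J, c.deco = j) ∧
        Annotated (dropAnn J c.deco) c := by
      intro c h
      rcases of_mem_pieces h with ⟨x, hx, rfl⟩ | ⟨x, hx, p, hp, a, -, rfl⟩ |
        ⟨x, hx, p, hp, a, -, rfl⟩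
      · rw [deco_remove]
        exact ⟨hd x hx, (hc x hx).annotated.mapNodes _ _⟩
      · exact ⟨hd x hx, (settled_leaf _ _ _ _).annotated⟩
      · exact ⟨predAnn_eq_bot_or _ _, (settled_leaf _ _ _ _).annotated⟩
    have hs : ∀ c ∈ settled A fresh J cs L, (c.deco = ⊥ ∨ ∃ j ∈ J, c.deco = j) ∧
        Annotated (dropAnn J c.deco) c := by
      intro c h
      obtain ⟨x, hx, R, rfl, -⟩ := of_mem_settle isLabelling_leafStates h
      rw [deco_prune, deco_remove]
      exact ⟨(hp x hx).1, ((hp x hx).2.mapNodes _ _).prune _⟩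
    exact ⟨fun c h => (hs c h).1, fun c h => (hs c h).2⟩
  · refine settle_separated isLabelling_leafStates fun c h => ?_
    rcases of_mem_pieces h with ⟨x, hx, rfl⟩ | ⟨x, hx, p, hp, a, -, rfl⟩ |
      ⟨x, hx, p, hp, a, -, rfl⟩
    · exact (hc x hx).separated.remove isLabelling_leafStates _
    all_goals simp [separated_node]
  · have := settle_reduced (ann := deco) isLabelling_leafStates (pieces A fresh J cs L)
    exact ⟨fun c h => (this c h).1, fun c h => (this c h).2⟩
  · rw [hl, depth_node_le]
    refine settle_depth_le isLabelling_leafStates (fun R t => deco_remove R t)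
      (fun t => deco_prune _ t) ?_ ?_ h
    · intro c h hb
      rcases of_mem_pieces h with ⟨x, hx, rfl⟩ | ⟨x, hx, p, hp, a, -, rfl⟩ |
        ⟨x, hx, p, hp, a, -, rfl⟩
      · rw [deco_remove] at hb
        obtain ⟨j, hj, hxj⟩ := (hd x hx).resolve_left hb
        have h1 := (hc x hx).depth_le
        have h2 := Finset.card_le_card (hsub x hx)
        have h3 : depth (x.remove (annSet A.F x.deco)) ≤ depth x := depth_mapNodes_le _ _ _
        have h4 := Finset.card_erase_add_one hj
        rw [hxj, dropAnn_coe] at h1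
        rw [hxj] at h3 ⊢
        omega
      all_goals
        -- A new child is a leaf, so a single state below the node already pays for it.
        have := Finset.card_pos.2 ⟨p, hsub x hx hp⟩
        simp only [depth, depthList]
        omega
    · intro c h hb w hw hwb q hqw hqc
      have hq : q ∈ leafStatesList cs := by
        rw [← leafStatesList_settled A fresh J cs L, mem_leafStatesList, settled,
          mem_settle_iff isLabelling_leafStates]
        exact ⟨w, hw, hqw⟩
      rcases of_mem_pieces h with ⟨x, hx, rfl⟩ | ⟨x, hx, p, hp, a, -, rfl⟩ |
        ⟨x, hx, p, hp, a, -, rfl⟩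
      · rw [deco_remove] at hb
        rw [leafStates_remove, hb, annSet_bot, Finset.sdiff_empty] at hqc
        have h1 := (hc x hx).depth_le
        have h2 := Finset.card_lt_card
          ((Finset.ssubset_iff_of_subset (hsub x hx)).2 ⟨q, hq, hqc⟩)
        have h3 : depth (x.remove (annSet A.F x.deco)) ≤ depth x := depth_mapNodes_le _ _ _
        rw [hb, dropAnn_bot] at h1
        omega
      all_goals
        have := Finset.card_pos.2 ⟨q, hq⟩
        simp only [depth, depthList]
        omega

theorem recLeaf_good (A : NSW α N k) (fresh : Finset ℕ → ℕ) (b : ℕ) (J : Finset (Fin k))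
    (a : ℕ) (d : WithBot (Fin k)) (S : Finset (Fin N)) (L : Log) :
    (recLeaf A fresh b J a d S L).1.deco = d ∧
      (recLeaf A fresh b J a d S L).1.leafStates = S ∧
      Settled J (recLeaf A fresh b J a d S L).1 := by
  induction b generalizing J a d L with
  | zero => exact ⟨rfl, rfl, settled_leaf _ _ _ _⟩
  | succ b ih =>
    have h := ih (dropAnn J J.max) (fresh L.used) J.max ⟨insert (fresh L.used) L.used, L.succ⟩
    refine ⟨deco_finish _ _ _ _ _ _ _, ?_, ?_⟩
    · rw [recLeaf, leafStates_finish]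
      simp [leafStatesList, h.2.1]
    · rw [recLeaf]
      refine settled_finish _ _ _ _ _ _ _ ?_ ?_
      · simp only [List.mem_singleton, forall_eq]
        rw [h.1]
        rcases hm : J.max with _ | j
        · exact Or.inl rfl
        · exact Or.inr ⟨j, Finset.mem_of_max hm, rfl⟩
      · simp only [List.mem_singleton, forall_eq]
        rw [h.1]
        exact h.2.2

theorem recList_forall₂ (A : NSW α N k) (fresh : Finset ℕ → ℕ) (J : Finset (Fin k))
    (cs : List (QHTree N k)) (L : Log) :
    List.Forall₂ (fun c r => ∃ L', r = (recTree A fresh c (dropAnn J c.deco) L').1) cs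
      (recList A fresh cs J L).1 := by
  induction cs generalizing L with
  | nil => simp [recList]
  | cons c cs ih =>
    rw [recList]
    exact .cons ⟨L, rfl⟩ (ih _)

theorem recTree_node {A : NSW α N k} {fresh : Finset ℕ → ℕ} {a : ℕ} {d : WithBot (Fin k)}
    {S : Finset (Fin N)} {cs : List (QHTree N k)} {J : Finset (Fin k)} {L : Log} (h : cs ≠ []) :
    recTree A fresh (node a d S cs) J L =
      finish A fresh J a d (recList A fresh cs J L).1 (recList A fresh cs J L).2 := by
  cases cs with
  | nil => exact absurd rfl h
  | cons c cs => simp only [recTree, recList]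

theorem forall₂_mem_right {γ δ : Type} {R : γ → δ → Prop} {l : List γ} {l' : List δ}
    (h : List.Forall₂ R l l') {y : δ} (hy : y ∈ l') : ∃ x ∈ l, R x y := by
  induction h with
  | nil => simp at hy
  | cons hr _ ih =>
    rcases List.mem_cons.1 hy with rfl | hy
    · exact ⟨_, by simp, hr⟩
    · obtain ⟨x, hx, hxy⟩ := ih hy
      exact ⟨x, by simp [hx], hxy⟩

theorem forall₂_mem_left {γ δ : Type} {R : γ → δ → Prop} {l : List γ} {l' : List δ}
    (h : List.Forall₂ R l l') {x : γ} (hx : x ∈ l) : ∃ y ∈ l', R x y :=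
  forall₂_mem_right h.flip hx

theorem deco_recTree (A : NSW α N k) (fresh : Finset ℕ → ℕ) (t : QHTree N k)
    (J : Finset (Fin k)) (L : Log) : (recTree A fresh t J L).1.deco = t.deco := by
  rcases t with ⟨a, d, S, _ | ⟨c, cs⟩⟩
  · exact (recLeaf_good _ _ _ _ _ _ _ _).1
  · exact deco_finish _ _ _ _ _ _ _

theorem leafStates_recTree (A : NSW α N k) (fresh : Finset ℕ → ℕ) (t : QHTree N k)
    (J : Finset (Fin k)) (L : Log) : (recTree A fresh t J L).1.leafStates = t.leafStates := by
  induction t using induct generalizing J L with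
  | h a d S cs ih =>
    by_cases h : cs = []
    · subst h
      rw [recTree]
      exact (recLeaf_good _ _ _ _ _ _ _ _).2.1
    · rw [recTree_node h, leafStates_finish, leafStates_node h]
      have hf := recList_forall₂ A fresh J cs L
      ext q
      rw [mem_leafStatesList, mem_leafStatesList]
      constructor
      · rintro ⟨r, hr, hq⟩
        obtain ⟨c, hc, L', rfl⟩ := forall₂_mem_right hf hr
        exact ⟨c, hc, by rwa [ih c hc] at hq⟩
      · rintro ⟨c, hc, hq⟩
        obtain ⟨r, hr, L', rfl⟩ := forall₂_mem_left hf hc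
        exact ⟨_, hr, by rwa [ih c hc]⟩

theorem settled_recTree (A : NSW α N k) (fresh : Finset ℕ → ℕ) {t : QHTree N k}
    {J : Finset (Fin k)} (L : Log) (ht : Annotated J t) :
    Settled J (recTree A fresh t J L).1 := by
  induction t using induct generalizing J L with
  | h a d S cs ih =>
    by_cases h : cs = []
    · subst h
      rw [recTree]
      exact (recLeaf_good _ _ _ _ _ _ _ _).2.2
    · rw [annotated_node] at ht
      rw [recTree_node h]
      have hf := recList_forall₂ A fresh J cs L
      refine settled_finish _ _ _ _ _ _ _ ?_ ?_
      · intro r hr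
        obtain ⟨c, hc, L', rfl⟩ := forall₂_mem_right hf hr
        rw [deco_recTree]
        exact ht.1 c hc
      · intro r hr
        obtain ⟨c, hc, L', rfl⟩ := forall₂_mem_right hf hr
        rw [deco_recTree]
        exact ih c hc L' (ht.2 c hc)

/-! ### Names -/

theorem finish_names (A : NSW α N k) (fresh : Finset ℕ → ℕ) (J : Finset (Fin k)) (a : ℕ)
    (d : WithBot (Fin k)) (cs : List (QHTree N k)) (L : Log) (ha : a ∈ L.used)
    (hc : ∀ c ∈ cs, c.names ⊆ L.used) :
    Extends fresh L.used (finish A fresh J a d cs L).2.used ∧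
      (finish A fresh J a d cs L).1.names ⊆ (finish A fresh J a d cs L).2.used := by
  have hE := spawn_extends fresh (cs.flatMap (newChildren A J)) L.used
  have hu : (finish A fresh J a d cs L).2.used =
      (spawn fresh L.used (cs.flatMap (newChildren A J))).2 := by
    simp only [finish]
    split_ifs <;> rfl
  rw [hu]
  refine ⟨hE, ?_⟩
  rw [finish_fst]
  split_ifs
  · simpa [names, namesList] using hE.subset ha
  · refine Finset.insert_subset (hE.subset ha) ?_
    refine namesList_settle_subset isLabelling_leafStates fun c h => ?_
    rcases List.mem_append.1 h with h | h
    · obtain ⟨x, hx, rfl⟩ := List.mem_map.1 h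
      rw [names_remove]
      exact (hc x hx).trans hE.subset
    · exact names_spawn_subset _ _ _ c h

theorem recLeaf_names (A : NSW α N k) (fresh : Finset ℕ → ℕ) (b : ℕ) (J : Finset (Fin k))
    (a : ℕ) (d : WithBot (Fin k)) (S : Finset (Fin N)) (L : Log) (ha : a ∈ L.used) :
    Extends fresh L.used (recLeaf A fresh b J a d S L).2.used ∧
      (recLeaf A fresh b J a d S L).1.names ⊆ (recLeaf A fresh b J a d S L).2.used := by
  induction b generalizing J a d L with
  | zero =>
    rw [recLeaf]
    exact ⟨.refl, by simpa [names, namesList] using ha⟩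
  | succ b ih =>
    have h := ih (dropAnn J J.max) (fresh L.used) J.max ⟨insert (fresh L.used) L.used, L.succ⟩
      (Finset.mem_insert_self _ _)
    have h1 : Extends fresh L.used (insert (fresh L.used) L.used) := .step .refl
    rw [recLeaf]
    have h2 := finish_names A fresh J a d [(recLeaf A fresh b (dropAnn J J.max) (fresh L.used)
      J.max S ⟨insert (fresh L.used) L.used, L.succ⟩).1] _ ((h1.trans h.1).subset ha)
      (by simpa using h.2)
    exact ⟨(h1.trans h.1).trans h2.1, h2.2⟩

theorem recTree_names (A : NSW α N k) (fresh : Finset ℕ → ℕ) (t : QHTree N k)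
    (J : Finset (Fin k)) (L : Log) (ht : t.names ⊆ L.used) :
    Extends fresh L.used (recTree A fresh t J L).2.used ∧
      (recTree A fresh t J L).1.names ⊆ (recTree A fresh t J L).2.used := by
  induction t using induct generalizing J L with
  | h a d S cs ih =>
    rw [names, Finset.insert_subset_iff] at ht
    -- The induction runs over lists of children of this node, so that the hypothesis `ih` stays
    -- applicable while the log changes.
    have hl : ∀ (l : List (QHTree N k)) (L : Log), (∀ c ∈ l, c ∈ cs) → namesList l ⊆ L.used →
        Extends fresh L.used (recList A fresh l J L).2.used ∧
          ∀ c ∈ (recList A fresh l J L).1, c.names ⊆ (recList A fresh l J L).2.used := by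
      intro l
      induction l with
      | nil => exact fun L _ _ => ⟨by rw [recList]; exact .refl, by simp [recList]⟩
      | cons c l ihl =>
        intro L hm hn
        rw [namesList, Finset.union_subset_iff] at hn
        have h1 := ih c (hm c (by simp)) (dropAnn J c.deco) L hn.1
        have h2 := ihl (recTree A fresh c (dropAnn J c.deco) L).2
          (fun x hx => hm x (by simp [hx])) (hn.2.trans h1.1.subset)
        rw [recList]
        refine ⟨h1.1.trans h2.1, ?_⟩
        simp only [List.mem_cons, forall_eq_or_imp]
        exact ⟨h1.2.trans h2.1.subset, h2.2⟩
    by_cases h : cs = []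
    · subst h
      rw [recTree]
      exact recLeaf_names _ _ _ _ _ _ _ _ ht.1
    · have h1 := hl cs L (fun _ h => h) ht.2
      rw [recTree_node h]
      have h2 := finish_names A fresh J a d _ _ (h1.1.subset ht.1) h1.2
      exact ⟨h1.1.trans h2.1, h2.2⟩

end Safra
end OmegaDet

-- The lower bound: paths of single states as counters

namespace OmegaDet
namespace Safra

open STree

variable {α : Type} {N k : ℕ}

/-- The state `q` belongs to a leaf whose path from the root has the annotations `p`. -/
inductive At : QHTree N k → Fin N → List (Fin k) → Prop
  | leaf {a : ℕ} {d : WithBot (Fin k)} {S : Finset (Fin N)} {q : Fin N} (h : q ∈ S) :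
      At (node a d S []) q []
  | child {a : ℕ} {d : WithBot (Fin k)} {S : Finset (Fin N)} {cs : List (QHTree N k)}
      {c : QHTree N k} {j : Fin k} {q : Fin N} {p : List (Fin k)} (hc : c ∈ cs)
      (hd : c.deco = j) (h : At c q p) : At (node a d S cs) q (j :: p)

theorem At.mem_leafStates {t : QHTree N k} {q : Fin N} {p : List (Fin k)} (h : At t q p) :
    q ∈ t.leafStates := by
  induction h with
  | leaf h => exact h
  | child hc _ _ ih =>
    rw [leafStates_node (List.ne_nil_of_mem hc)]
    exact mem_leafStatesList.2 ⟨_, hc, ih⟩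

theorem At.mapNodes {t : QHTree N k} {q q' : Fin N} {p : List (Fin k)} (h : At t q p)
    (f : ℕ → ℕ) (g : Finset (Fin N) → Finset (Fin N)) (hg : ∀ S, q ∈ S → q' ∈ g S) :
    At (mapNodes f g t) q' p := by
  induction h with
  | leaf h => rw [mapNodes_node]; exact .leaf (hg _ h)
  | child hc hd _ ih =>
    rw [mapNodes_node]
    exact .child (List.mem_map_of_mem hc) (by rw [deco_mapNodes, hd]) (ih hg)

theorem At.remove {t : QHTree N k} {q : Fin N} {p : List (Fin k)} (h : At t q p)
    {R : Finset (Fin N)} (hR : q ∉ R) : At (t.remove R) q p :=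
  h.mapNodes _ _ fun _ hS => Finset.mem_sdiff.2 ⟨hS, hR⟩

theorem At.prune {t : QHTree N k} {q : Fin N} {p : List (Fin k)} (h : At t q p) :
    At (prune leafStates t) q p := by
  induction h with
  | leaf h => rw [prune_node]; exact .leaf h
  | child hc hd h ih =>
    rw [prune_node]
    refine .child (List.mem_map_of_mem (List.mem_filter.2 ⟨hc, ?_⟩)) (by rw [deco_prune, hd]) ih
    simpa using Finset.ne_empty_of_mem h.mem_leafStates

theorem eq_of_pairwise_disjoint {γ : Type} {f : γ → Finset (Fin N)} {l : List γ}
    (h : l.Pairwise fun c c' => Disjoint (f c) (f c')) {x y : γ} (hx : x ∈ l) (hy : y ∈ l)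
    {q : Fin N} (hqx : q ∈ f x) (hqy : q ∈ f y) : x = y := by
  by_contra hne
  have : Std.Symm fun c c' : γ => Disjoint (f c) (f c') := ⟨fun _ _ h => h.symm⟩
  exact Finset.disjoint_left.1 (h.forall hx hy hne) hqx hqy

/-- Disjoint siblings leave only one way down to `q`. This makes the path an invariant by which
trees are told apart. -/
theorem At.unique {t : QHTree N k} {q : Fin N} {p p' : List (Fin k)} (h : At t q p)
    (h' : At t q p') (ht : Separated leafStates t) : p = p' := by
  induction h generalizing p' with
  | leaf h =>
    cases h' with
    | leaf h => rfl
    | child hc _ _ => simp at hc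
  | child hc hd h ih =>
    cases h' with
    | leaf h => simp at hc
    | child hc' hd' h' =>
      rw [separated_node] at ht
      obtain rfl := eq_of_pairwise_disjoint ht.2 hc hc' h.mem_leafStates h'.mem_leafStates
      rw [hd] at hd'
      rw [WithBot.coe_injective hd', ih h' (ht.1 _ hc)]

/-- The effect of a transition on the path of a state that belongs to the sets `E j` with
`j ∈ e`, and to none of the sets `F j`. -/
inductive Moves (e : Set (Fin k)) : Finset (Fin k) → List (Fin k) → List (Fin k) → Prop
  | done : Moves e ∅ [] []
  | expand {J : Finset (Fin k)} {j : Fin k} {p : List (Fin k)} (hj : J.max = j)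
      (h : Moves e J [j] p) : Moves e J [] p
  | keep {J : Finset (Fin k)} {j : Fin k} {p p' : List (Fin k)} (hj : j ∉ e)
      (h : Moves e (J.erase j) p p') : Moves e J (j :: p) (j :: p')
  | lower {J : Finset (Fin k)} {i j : Fin k} {p : List (Fin k)} (hj : j ∈ e)
      (hi : predAnn J j = i) : Moves e J (j :: p) [i]

/-- The child that keeps `q` has an annotation other than `⊥`, so the node is not reset and the path
survives, whatever happens to other states. -/
theorem at_finish {A : NSW α N k} {fresh : Finset ℕ → ℕ} {J : Finset (Fin k)} {a : ℕ}
    {d : WithBot (Fin k)} {cs : List (QHTree N k)} {L : Log} {q : Fin N} {j : Fin k}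
    {p : List (Fin k)}
    (h : ∀ x ∈ settled A fresh J cs L, q ∈ x.leafStates → x.deco = j ∧ At x q p)
    (hq : q ∈ leafStatesList cs) : At (finish A fresh J a d cs L).1 q (j :: p) := by
  rw [← leafStatesList_settled A fresh J cs L, mem_leafStatesList] at hq
  obtain ⟨x, hx, hqx⟩ := hq
  obtain ⟨hd, hx'⟩ := h x hx hqx
  rw [finish_fst, if_neg]
  · exact .child hx hd hx'
  · intro hbot
    rw [hbot x hx] at hd
    exact WithBot.bot_ne_coe hd

/-- No new child is created for `q`, so every candidate that contains it is an old child with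
annotation `j`. -/
theorem at_finish_keep {A : NSW α N k} {fresh : Finset ℕ → ℕ} {J : Finset (Fin k)} {a : ℕ}
    {d : WithBot (Fin k)} {cs : List (QHTree N k)} {L : Log} {q : Fin N} {j : Fin k}
    {p : List (Fin k)} (hF : ∀ i, q ∉ A.F i) (hE : q ∉ A.E j)
    (h : ∀ x ∈ cs, q ∈ x.leafStates → x.deco = j ∧ At x q p)
    (hq : q ∈ leafStatesList cs) : At (finish A fresh J a d cs L).1 q (j :: p) := by
  refine at_finish (fun x hx hqx => ?_) hq
  obtain ⟨y, hy, R, rfl, he, -⟩ := of_mem_settle isLabelling_leafStates hx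
  rw [he, Finset.mem_sdiff] at hqx
  have hy' : y.deco = j ∧ At y q p := by
    rcases of_mem_pieces hy with ⟨x, hxc, rfl⟩ | ⟨x, hxc, r, hr, a, hT, rfl⟩ |
        ⟨x, hxc, r, hr, a, hT, rfl⟩
    · rw [leafStates_remove, Finset.mem_sdiff] at hqx
      rw [deco_remove]
      exact ⟨(h x hxc hqx.1.1).1, (h x hxc hqx.1.1).2.remove hqx.1.2⟩
    all_goals
      obtain rfl : q = r := by simpa [leafStates] using hqx.1
      rw [(h x hxc hr).1, annSet_coe] at hT
    · exact absurd hT (hF j)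
    · exact absurd hT hE
  rw [deco_prune, deco_remove]
  exact ⟨hy'.1, (hy'.2.remove hqx.2).prune⟩

/-- The new child `{q}` has the smaller annotation `i`, so separation takes `q` away from the old
subtree, whatever its path there was. -/
theorem at_finish_lower {A : NSW α N k} {fresh : Finset ℕ → ℕ} {J : Finset (Fin k)} {a : ℕ}
    {d : WithBot (Fin k)} {cs : List (QHTree N k)} {L : Log} {q : Fin N} {i j : Fin k}
    (hF : ∀ i, q ∉ A.F i) (hE : q ∈ A.E j) (hi : predAnn J j = i)
    (h : ∀ x ∈ cs, q ∈ x.leafStates → x.deco = j)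
    (hq : q ∈ leafStatesList cs) : At (finish A fresh J a d cs L).1 q [i] := by
  refine at_finish (fun x hx hqx => ?_) hq
  obtain ⟨y, hy, R, rfl, he, -, hmin⟩ := of_mem_settle isLabelling_leafStates hx
  obtain ⟨c, hc, hqc⟩ := mem_leafStatesList.1 hq
  obtain ⟨b, hb⟩ := exists_mem_spawn fresh L.used (List.mem_flatMap.2
        ⟨c, hc, mem_newChildren.2 ⟨q, hqc, Or.inr ⟨by rw [h c hc hqc]; exact hE, rfl⟩⟩⟩)
  have hnlt := fun hlt => hmin q hqx _ (List.mem_append_right _ hb) hlt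
    (by simp [leafStates])
  rw [h c hc hqc, hi] at hnlt
  rw [he, Finset.mem_sdiff] at hqx
  have hy' : y.deco = i ∧ At y q [] := by
    rcases of_mem_pieces hy with ⟨x, hxc, rfl⟩ | ⟨x, hxc, r, hr, a, hT, rfl⟩ |
        ⟨x, hxc, r, hr, a, hT, rfl⟩
    · rw [leafStates_remove, Finset.mem_sdiff] at hqx
      refine absurd ?_ hnlt
      rw [deco_remove, h x hxc hqx.1.1]
      exact predAnn_lt hi
    all_goals
      obtain rfl : q = r := by simpa [leafStates] using hqx.1
      rw [h x hxc hr] at hT ⊢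
    · exact absurd hT (hF j)
    · exact ⟨hi, .leaf (by simp)⟩
  rw [deco_prune, deco_remove]
  exact ⟨hy'.1, (hy'.2.remove hqx.2).prune⟩

theorem at_recLeaf {A : NSW α N k} {fresh : Finset ℕ → ℕ} {q : Fin N} (hF : ∀ i, q ∉ A.F i)
    {b : ℕ} {J : Finset (Fin k)} {a : ℕ} {d : WithBot (Fin k)} {S : Finset (Fin N)} {L : Log}
    {p : List (Fin k)} (hb : J.card = b) (hp : Moves {j | q ∈ A.E j} J [] p) (hq : q ∈ S) :
    At (recLeaf A fresh b J a d S L).1 q p := by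
  induction b generalizing J a d L p with
  | zero =>
    obtain rfl := Finset.card_eq_zero.1 hb
    cases hp with
    | done => exact .leaf hq
    | expand hj _ => simp at hj
  | succ b ih =>
    cases hp with
    | done => simp at hb
    | @expand _ j _ hj h =>
      have hjJ := Finset.mem_of_max hj
      rw [recLeaf, hj, dropAnn_coe]
      have hg := recLeaf_good A fresh b (J.erase j) (fresh L.used) j S
        ⟨insert (fresh L.used) L.used, L.succ⟩
      cases h with
      | keep hE h =>
        refine at_finish_keep hF hE ?_ ?_
        · simp only [List.mem_singleton, forall_eq]
          exact fun _ => ⟨hg.1, ih (by rw [Finset.card_erase_of_mem hjJ, hb]; rfl) h⟩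
        · simpa [leafStatesList, hg.2.1] using hq
      | lower hE hi =>
        refine at_finish_lower hF hE hi ?_ ?_
        · simp only [List.mem_singleton, forall_eq]
          exact fun _ => hg.1
        · simpa [leafStatesList, hg.2.1] using hq

theorem at_recTree {A : NSW α N k} {fresh : Finset ℕ → ℕ} {q : Fin N} (hF : ∀ i, q ∉ A.F i)
    {t : QHTree N k} {J : Finset (Fin k)} {L : Log} {p p' : List (Fin k)}
    (ht : Separated leafStates t) (hq : At t q p) (hp : Moves {j | q ∈ A.E j} J p p') :
    At (recTree A fresh t J L).1 q p' := by
  induction hq generalizing J L p' with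
  | leaf h => rw [recTree]; exact at_recLeaf hF rfl hp h
  | @child a d S cs c j q p hc hd h ih =>
    rw [recTree_node (List.ne_nil_of_mem hc)]
    have hf := recList_forall₂ A fresh J cs L
    have hmem : q ∈ leafStatesList (recList A fresh cs J L).1 := by
      obtain ⟨r, hr, L', rfl⟩ := forall₂_mem_left hf hc
      refine mem_leafStatesList.2 ⟨_, hr, ?_⟩
      rw [leafStates_recTree]
      exact h.mem_leafStates
    rw [separated_node] at ht
    have hr : ∀ r ∈ (recList A fresh cs J L).1, q ∈ r.leafStates →
        ∃ L', r = (recTree A fresh c (dropAnn J j) L').1 := by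
      intro r hr hqr
      obtain ⟨c', hc', L', rfl⟩ := forall₂_mem_right hf hr
      rw [leafStates_recTree] at hqr
      obtain rfl := eq_of_pairwise_disjoint ht.2 hc' hc hqr h.mem_leafStates
      exact ⟨L', by rw [hd]⟩
    cases hp with
    | keep hE hp =>
      refine at_finish_keep hF hE (fun r hr' hqr => ?_) hmem
      obtain ⟨L', rfl⟩ := hr r hr' hqr
      rw [deco_recTree]
      exact ⟨hd, ih hF (ht.1 c hc) (by rwa [dropAnn_coe])⟩
    | lower hE hi =>
      refine at_finish_lower hF hE hi (fun r hr' hqr => ?_) hmem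
      obtain ⟨L', rfl⟩ := hr r hr' hqr
      rw [deco_recTree]
      exact hd

/-- Injectivity of `π` keeps labels disjoint when they are advanced, so states do not compete with
each other and each path can be followed separately. -/
theorem at_next {A : NSW α N k} {fresh : Finset ℕ → ℕ} {t : QHTree N k} {σ : α}
    (π : Equiv.Perm (Fin N)) (hσ : ∀ q, A.δ q σ = {π q}) (ht : Separated leafStates t)
    {q : Fin N} {p p' : List (Fin k)} (hF : ∀ i, π q ∉ A.F i) (hq : At t q p)
    (hp : Moves {j | π q ∈ A.E j} Finset.univ p p') :
    At (next A fresh t σ).1 (π q) p' := by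
  refine at_recTree hF ?_ (hq.mapNodes _ _ fun S hS => ?_) hp
  · refine ht.mapNodes _ _ (fun t => leafStates_mapNodes _ _ ?_ ?_ t) ?_
    · exact fun S T => Finset.union_biUnion
    · simp
    · intro S T hd
      simp only [hσ, Finset.disjoint_left, Finset.mem_biUnion, Finset.mem_singleton] at hd ⊢
      rintro x ⟨y, hy, rfl⟩ ⟨z, hz, he⟩
      exact hd hy (π.injective he ▸ hz)
  · exact Finset.mem_biUnion.2 ⟨q, hS, by simp [hσ]⟩

/-! ### Paths -/

/-- Storage: the path of a state in no set of the table is only prolonged. The last clause says that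
a path starting from a leaf root begins with the top annotation. -/
theorem moves_idle {e : Set (Fin k)} (he : ∀ j, j ∉ e) (J : Finset (Fin k)) (p : List (Fin k)) :
    ∃ p', Moves e J p p' ∧ p <+: p' ∧ ∀ j : Fin k, p = [] → J.max = j → [j] <+: p' := by
  induction p generalizing J with
  | nil =>
    induction hb : J.card generalizing J with
    | zero =>
      obtain rfl := Finset.card_eq_zero.1 hb
      exact ⟨[], .done, by simp, fun j _ h => by simp at h⟩
    | succ b ih =>
      obtain ⟨j, hj⟩ := Finset.max_of_nonempty (s := J) (Finset.card_pos.1 (by omega))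
      obtain ⟨p', hp', -⟩ := ih (J.erase j)
        (by rw [Finset.card_erase_of_mem (Finset.mem_of_max hj)]; omega)
      refine ⟨j :: p', .expand hj (.keep (he j) hp'), by simp, fun i _ h => ?_⟩
      rw [hj] at h
      obtain rfl := WithBot.coe_injective h
      simp
  | cons j p ih =>
    obtain ⟨p', hp', h, -⟩ := ih (J.erase j)
    exact ⟨j :: p', .keep (he j) hp', by simpa using h, by simp⟩

theorem mem_foldl_erase (u : List (Fin k)) (J : Finset (Fin k)) (j : Fin k) :
    j ∈ u.foldl Finset.erase J ↔ j ∈ J ∧ j ∉ u := by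
  induction u generalizing J with
  | nil => simp
  | cons i u ih =>
    simp only [List.foldl_cons, ih, Finset.mem_erase, List.mem_cons]
    tauto

theorem moves_append {e : Set (Fin k)} {u p p' : List (Fin k)} {J : Finset (Fin k)}
    (hu : ∀ j ∈ u, j ∉ e) (h : Moves e (u.foldl Finset.erase J) p p') :
    Moves e J (u ++ p) (u ++ p') := by
  induction u generalizing J with
  | nil => exact h
  | cons j u ih => exact .keep (hu j (by simp)) (ih (fun i hi => hu i (by simp [hi])) h)

theorem predAnn_eq {J : Finset (Fin k)} {i j : Fin k} (hij : i.val + 1 = j.val) (hi : i ∈ J) :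
    predAnn J j = i := by
  rw [predAnn]
  refine le_antisymm (Finset.max_le fun x hx => ?_) (Finset.le_max ?_)
  · have := (Finset.mem_filter.1 hx).2
    rw [WithBot.coe_lt_coe, Fin.lt_def] at this
    rw [WithBot.coe_le_coe, Fin.le_def]
    omega
  · refine Finset.mem_filter.2 ⟨hi, ?_⟩
    rw [WithBot.coe_lt_coe, Fin.lt_def]
    omega

theorem moves_lower {e : Set (Fin k)} {u p : List (Fin k)} {i j : Fin k}
    (hu : ∀ j ∈ u, j ∉ e) (hj : j ∈ e) (hij : i.val + 1 = j.val) (hi : i ∉ u) :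
    Moves e Finset.univ (u ++ j :: p) (u ++ [i]) :=
  moves_append hu (.lower hj (predAnn_eq hij ((mem_foldl_erase _ _ _).2 ⟨by simp, hi⟩)))

/-- At the leaf the top annotation `j` is still in the witness set, because `u` avoids `e`. The leaf
is expanded by `j`, and the same transition lowers this new annotation to `i`. -/
theorem moves_expand_lower {e : Set (Fin k)} {u : List (Fin k)} {i j : Fin k}
    (hu : ∀ j ∈ u, j ∉ e) (hj : j ∈ e) (hij : i.val + 1 = j.val) (hi : i ∉ u)
    (htop : j.val + 1 = k) : Moves e Finset.univ u (u ++ [i]) := by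
  have h : Moves e Finset.univ (u ++ []) (u ++ [i]) := by
    refine moves_append hu (.expand (j := j) ?_ (.lower hj
      (predAnn_eq hij ((mem_foldl_erase _ _ _).2 ⟨by simp, hi⟩))))
    refine le_antisymm (Finset.max_le fun x _ => ?_)
      (Finset.le_max ((mem_foldl_erase _ _ _).2 ⟨by simp, fun h => hu j h hj⟩))
    rw [WithBot.coe_le_coe, Fin.le_def]
    omega
  rwa [List.append_nil] at h

/-- The paths of a state at which no transition has changed an annotation. -/
def Untouched (p : List (Fin k)) : Prop :=
  p = [] ∨ ∃ j p', p = j :: p' ∧ j.val + 1 = k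

/-- A set of trees that is closed under the effect of all permutations of the states. -/
structure PermClosed (A : NSW α N k) (R : Set (QHTree N k)) : Prop where
  init : ∃ t ∈ R, Separated leafStates t ∧ ∀ q ∈ A.init, At t q []
  step : ∀ t ∈ R, Separated leafStates t → ∀ π : Equiv.Perm (Fin N),
    ∃ t' ∈ R, Separated leafStates t' ∧ ∀ q p p', At t q p → (∀ i, π q ∉ A.F i) →
      Moves {j | π q ∈ A.E j} Finset.univ p p' → At t' (π q) p'

/-- The states of `A` that the lower bound uses: `n` storage states `r i`, which belong to no
set of the table, and `n` states `s l`, where `s l ∈ E j` iff `B l ≤ j`. -/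
structure Counters (A : NSW α N k) (n : ℕ) (B : ℕ → ℕ) where
  r : Fin n → Fin N
  s : ℕ → Fin N
  r_inj : Function.Injective r
  r_ne_s : ∀ i, ∀ l < n, r i ≠ s l
  r_init : ∀ i, r i ∈ A.init
  r_E : ∀ i j, r i ∉ A.E j
  r_F : ∀ i j, r i ∉ A.F j
  s_E : ∀ l < n, ∀ j, s l ∈ A.E j ↔ B l ≤ j.val
  s_F : ∀ l < n, ∀ j, s l ∉ A.F j

section Counters

variable {A : NSW α N k} {n : ℕ} {B : ℕ → ℕ} {R : Set (QHTree N k)}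

theorem Untouched.moves {e : Set (Fin k)} {p : List (Fin k)} (h : Untouched p) {i j : Fin k}
    (hj : j ∈ e) (hij : i.val + 1 = j.val) (htop : j.val + 1 = k) :
    Moves e Finset.univ p [i] := by
  rcases h with rfl | ⟨j', p', rfl, hj'⟩
  · exact moves_expand_lower (u := []) (by simp) hj hij (by simp) htop
  · obtain rfl : j' = j := Fin.ext (by omega)
    exact moves_lower (u := []) (by simp) hj hij (by simp)

theorem untouched_of_idle {p p' : List (Fin k)} (h : Untouched p) (hpp : p <+: p')
    (hp : ∀ j : Fin k, p = [] → Finset.univ.max = (j : WithBot (Fin k)) → [j] <+: p') :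
    Untouched p' := by
  rcases h with rfl | ⟨j, q, rfl, hj⟩
  · rcases k with _ | k
    · cases p' with
      | nil => exact Or.inl rfl
      | cons j _ => exact j.elim0
    · obtain ⟨q, rfl⟩ := hp (Fin.last k) rfl (le_antisymm
        (Finset.max_le fun x _ => WithBot.coe_le_coe.2 (Fin.le_last x))
        (Finset.le_max (Finset.mem_univ _)))
      exact Or.inr ⟨Fin.last k, q, rfl, rfl⟩
  · obtain ⟨q', rfl⟩ := hpp
    exact Or.inr ⟨j, q ++ q', rfl, hj⟩

/-- Every storage state other than `r i` has a path with the property `G`. -/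
def Stored (C : Counters A n B) (G : Fin n → List (Fin k) → Prop) (i : Fin n)
    (t : QHTree N k) : Prop :=
  Separated leafStates t ∧ ∀ i' ≠ i, ∃ p, At t (C.r i') p ∧ G i' p

/-- The letter is the transposition of `x` and `y`: `y` takes over the place of `x` and acts on it,
while the storage states other than `r i` are fixed and idle. The case `x = y` is allowed and
repeats the action of `y`. -/
theorem step_one (C : Counters A n B) (hR : PermClosed A R) {G : Fin n → List (Fin k) → Prop}
    (hG : ∀ i p p', p <+: p' →
      (∀ j : Fin k, p = [] → Finset.univ.max = (j : WithBot (Fin k)) → [j] <+: p') →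
      G i p → G i p')
    {i : Fin n} {t : QHTree N k} (ht : t ∈ R) (hs : Stored C G i t) {x y : Fin N}
    (hx : ∀ i' ≠ i, C.r i' ≠ x) (hy : ∀ i' ≠ i, C.r i' ≠ y) (hyF : ∀ j, y ∉ A.F j)
    {p p' : List (Fin k)} (hp : At t x p) (hm : Moves {j | y ∈ A.E j} Finset.univ p p') :
    ∃ t' ∈ R, Stored C G i t' ∧ At t' y p' := by
  obtain ⟨t', ht', hs', hstep⟩ := hR.step t ht hs.1 (Equiv.swap x y)
  refine ⟨t', ht', ⟨hs', fun i' hi' => ?_⟩, ?_⟩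
  · obtain ⟨p, hp, hGp⟩ := hs.2 i' hi'
    have hf : Equiv.swap x y (C.r i') = C.r i' :=
      Equiv.swap_apply_of_ne_of_ne (hx i' hi') (hy i' hi')
    obtain ⟨p', hm, hpre, htop⟩ := moves_idle (e := {j | C.r i' ∈ A.E j})
      (fun j => C.r_E i' j) Finset.univ p
    have := hstep (C.r i') p p' hp (by rw [hf]; exact C.r_F i') (by rw [hf]; exact hm)
    rw [hf] at this
    exact ⟨p', this, hG i' p p' hpre htop hGp⟩
  · have := hstep x p p' hp (by rwa [Equiv.swap_apply_left]) (by rwa [Equiv.swap_apply_left])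
    rwa [Equiv.swap_apply_left] at this

variable (hB : Monotone B) (v : ℕ → Fin k) (hv : ∀ l < n, B l ≤ (v l).val ∧ (v l).val < B (l + 1))
  (hk : B n < k)

include hB hv in
theorem lt_of_mem_path {l : ℕ} (hl : l ≤ n) {j : Fin k} (hj : j ∈ (List.range l).map v) :
    j.val < B l := by
  obtain ⟨m, hm, rfl⟩ := List.mem_map.1 hj
  rw [List.mem_range] at hm
  exact (hv m (by omega)).2.trans_le (hB hm)

include hB hv hk in
/-- Counting down at level `l` to the value `v l`. -/
theorem count_down (C : Counters A n B) (hR : PermClosed A R)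
    {G : Fin n → List (Fin k) → Prop}
    (hG : ∀ i p p', p <+: p' →
      (∀ j : Fin k, p = [] → Finset.univ.max = (j : WithBot (Fin k)) → [j] <+: p') →
      G i p → G i p')
    {i : Fin n} {t : QHTree N k} (ht : t ∈ R) (hs : Stored C G i t) {x : Fin N}
    (hx : ∀ i' ≠ i, C.r i' ≠ x) {l : ℕ} (hl : l < n) {p : List (Fin k)} (hp : At t x p)
    (hm : ∀ i j : Fin k, i.val + 1 = j.val → j.val + 1 = k → i.val ≥ B l →
      Moves {j | C.s l ∈ A.E j} Finset.univ p ((List.range l).map v ++ [i])) :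
    ∃ t' ∈ R, Stored C G i t' ∧ At t' (C.s l) ((List.range (l + 1)).map v) := by
  have hBn : B (l + 1) ≤ B n := hB hl
  have hvl := hv l hl
  have hsl : ∀ i' ≠ i, C.r i' ≠ C.s l := fun i' _ => C.r_ne_s i' l hl
  -- The first letter leaves the annotation `k - 2` at level `l`; `b` counts the further decrements
  -- needed to reach `y`.
  have key : ∀ b : ℕ, ∀ y : Fin k, (v l).val ≤ y.val → y.val + 1 < k → y.val + b + 2 = k →
      ∃ t' ∈ R, Stored C G i t' ∧ At t' (C.s l) ((List.range l).map v ++ [y]) := by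
    intro b
    induction b with
    | zero =>
      intro y hy hyk hb
      exact step_one C hR hG ht hs hx hsl (C.s_F l hl) hp
        (hm y ⟨y.val + 1, hyk⟩ rfl (by simpa using hb) (by omega))
    | succ b ih =>
      intro y hy hyk hb
      obtain ⟨t', ht', hs', hp'⟩ := ih ⟨y.val + 1, hyk⟩ (by simp only; omega)
        (by simp only; omega) (by simp only; omega)
      -- The identity letter, as the transposition of `s l` with itself: the earlier levels lie
      -- below `B l` and are kept, and `y + 1 ≥ B l` is lowered to `y`.
      refine step_one C hR hG ht' hs' hsl hsl (C.s_F l hl) hp' (moves_lower ?_ ?_ rfl ?_)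
      · intro j hj
        have := lt_of_mem_path hB v hv hl.le hj
        simp only [Set.mem_ofPred_eq, C.s_E l hl]
        omega
      · simp only [Set.mem_ofPred_eq, C.s_E l hl]
        omega
      · intro hj
        have := lt_of_mem_path hB v hv hl.le hj
        omega
  rw [List.range_succ, List.map_append]
  exact key (k - (v l).val - 2) (v l) le_rfl (by omega) (by omega)

include hB hv hk in
/-- The annotations on the path of one state can be set to `v 0, …, v (n - 1)`. -/
theorem set_path (C : Counters A n B) (hR : PermClosed A R)
    {G : Fin n → List (Fin k) → Prop}
    (hG : ∀ i p p', p <+: p' →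
      (∀ j : Fin k, p = [] → Finset.univ.max = (j : WithBot (Fin k)) → [j] <+: p') →
      G i p → G i p')
    {i : Fin n} {t : QHTree N k} (ht : t ∈ R) (hs : Stored C G i t) {p : List (Fin k)}
    (hp : At t (C.r i) p) (hu : Untouched p) :
    ∃ t' ∈ R, Stored C G i t' ∧ ∃ p', At t' (C.r i) p' ∧ (List.range n).map v <+: p' := by
  have hr : ∀ i' ≠ i, C.r i' ≠ C.r i := fun i' h h' => h (C.r_inj h')
  have key : ∀ l < n, ∃ t' ∈ R, Stored C G i t' ∧
      At t' (C.s l) ((List.range (l + 1)).map v) := by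
    intro l
    induction l with
    | zero =>
      intro hl
      -- Level `0` starts from an untouched path, whose head, if any, is the top annotation `k - 1`;
      -- lowering it discards the rest.
      refine count_down hB v hv hk C hR hG ht hs hr hl hp fun a j haj hj hB' =>
        hu.moves ?_ haj hj
      simp only [Set.mem_ofPred_eq, C.s_E 0 hl]
      omega
    | succ l ih =>
      intro hl
      obtain ⟨t', ht', hs', hp'⟩ := ih (by omega)
      -- The place passes from `s l` to `s (l + 1)`, which grows a new top annotation below the
      -- levels already set.
      refine count_down hB v hv hk C hR hG ht' hs' (fun i' _ => C.r_ne_s i' l (by omega)) hl hp'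
        fun a j haj hj hB' => moves_expand_lower ?_ ?_ haj ?_ hj
      · intro j hj
        have := lt_of_mem_path hB v hv hl.le hj
        simp only [Set.mem_ofPred_eq, C.s_E _ hl]
        omega
      · simp only [Set.mem_ofPred_eq, C.s_E _ hl]
        omega
      · intro hj
        have := lt_of_mem_path hB v hv hl.le hj
        omega
  have hn := i.pos
  obtain ⟨t', ht', hs', hp'⟩ := key (n - 1) (by omega)
  rw [Nat.sub_add_cancel hn] at hp'
  obtain ⟨p', hm, hpre, -⟩ := moves_idle (e := {j | C.r i ∈ A.E j})
    (fun j => C.r_E i j) Finset.univ ((List.range n).map v)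
  -- The last counter state hands the place back to `r i`, where the values are stored.
  obtain ⟨t'', ht'', hs'', hp''⟩ := step_one C hR hG ht' hs'
    (fun i' _ => C.r_ne_s i' (n - 1) (by omega)) hr (C.r_F i) hp' hm
  exact ⟨t'', ht'', hs'', p', hp'', hpre⟩

end Counters

/-- The storage states are served in order. Both properties tracked for the others, carrying the
prescribed prefix and being untouched, survive idling. -/
theorem exists_paths {A : NSW α N k} {n : ℕ} {B : ℕ → ℕ} {R : Set (QHTree N k)}
    (C : Counters A n B) (hR : PermClosed A R) (hB : Monotone B) (hk : B n < k)
    (v : Fin n → ℕ → Fin k)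
    (hv : ∀ i, ∀ l < n, B l ≤ (v i l).val ∧ (v i l).val < B (l + 1)) :
    ∃ t ∈ R, Separated leafStates t ∧
      ∀ i, ∃ p, At t (C.r i) p ∧ (List.range n).map (v i) <+: p := by
  have key : ∀ m ≤ n, ∃ t ∈ R, Separated leafStates t ∧ ∀ i : Fin n, ∃ p, At t (C.r i) p ∧
      if i.val < m then (List.range n).map (v i) <+: p else Untouched p := by
    intro m
    induction m with
    | zero =>
      intro _
      obtain ⟨t, ht, hs, hp⟩ := hR.init
      exact ⟨t, ht, hs, fun i => ⟨[], hp _ (C.r_init i), by simp [Untouched]⟩⟩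
    | succ m ih =>
      intro hm
      obtain ⟨t, ht, hs, hp⟩ := ih (by omega)
      obtain ⟨p, hpm, hu⟩ := hp ⟨m, hm⟩
      rw [if_neg (by simp)] at hu
      obtain ⟨t', ht', hs', p', hp', hpre⟩ := set_path hB (v ⟨m, hm⟩) (hv _) hk C hR
        (G := fun i p => if i.val < m then (List.range n).map (v i) <+: p else Untouched p)
        (i := ⟨m, hm⟩) (fun i p p' hpre htop h => by
          split_ifs at h ⊢ with him
          · exact h.trans hpre
          · exact untouched_of_idle h hpre htop) ht ⟨hs, fun i' _ => hp i'⟩ hpm hu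
      refine ⟨t', ht', hs'.1, fun i => ?_⟩
      by_cases hi : i = ⟨m, hm⟩
      · subst hi
        exact ⟨p', hp', by rwa [if_pos (by simp)]⟩
      · obtain ⟨p, h1, h2⟩ := hs'.2 i hi
        refine ⟨p, h1, ?_⟩
        have hne : i.val ≠ m := fun h => hi (Fin.ext h)
        by_cases him : i.val < m
        · rw [if_pos him] at h2
          rwa [if_pos (by omega)]
        · rw [if_neg him] at h2
          rwa [if_neg (by omega)]
  obtain ⟨t, ht, hs, hp⟩ := key n le_rfl
  refine ⟨t, ht, hs, fun i => ?_⟩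
  obtain ⟨p, h1, h2⟩ := hp i
  rw [if_pos i.isLt] at h2
  exact ⟨p, h1, h2⟩

/-- Between consecutive thresholds there are `w` values, so each of the `n * n` levels of the
storage paths stores a digit in base `w`. -/
theorem pow_le_ncard {A : NSW α N k} {n w : ℕ} {R : Set (QHTree N k)}
    (C : Counters A n fun l => 1 + l * w) (hR : PermClosed A R) (hk : 1 + n * w < k)
    (hfin : R.Finite) : w ^ (n * n) ≤ R.ncard := by
  have hmono : Monotone fun l : ℕ => 1 + l * w := fun a b h => by
    simp only; gcongr
  let v : (Fin n → Fin n → Fin w) → Fin n → ℕ → Fin k := fun x i l =>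
    if h : l < n then ⟨1 + l * w + (x i ⟨l, h⟩).val, by
      have h1 := (x i ⟨l, h⟩).isLt
      have h2 : (l + 1) * w ≤ n * w := Nat.mul_le_mul_right w h
      rw [Nat.succ_mul] at h2
      -- The value for `l ≥ n` is never read.
      omega⟩ else ⟨0, by omega⟩
  have hv : ∀ x i l, ∀ h : l < n, (v x i l).val = 1 + l * w + (x i ⟨l, h⟩).val :=
    fun x i l h => by simp only [v, dif_pos h]
  choose t htR hts hp using fun x : Fin n → Fin n → Fin w =>
    exists_paths C hR hmono hk (v x) (fun i l h => by
      have h1 := (x i ⟨l, h⟩).isLt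
      rw [hv x i l h]
      simp only [Nat.succ_mul]
      omega)
  have hinj : Function.Injective t := by
    intro x y hxy
    funext i l
    obtain ⟨p, hp1, hp2⟩ := hp x i
    obtain ⟨p', hp1', hp2'⟩ := hp y i
    rw [hxy] at hp1
    obtain rfl := hp1.unique hp1' (hts y)
    have h1 := (List.prefix_of_prefix_length_le hp2 hp2' (by simp)).eq_of_length (by simp)
    have h2 := List.map_inj_left.1 h1 l.val (by simp)
    have h3 := congrArg Fin.val h2
    rw [hv x i l l.isLt, hv y i l l.isLt] at h3
    exact Fin.ext (by simpa using h3)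
  have h1 : (Set.range t).ncard ≤ R.ncard :=
    Set.ncard_le_ncard (by rintro _ ⟨x, rfl⟩; exact htR x) hfin
  rw [← Set.image_univ, Set.ncard_image_of_injective _ hinj, Set.ncard_univ,
    Nat.card_eq_fintype_card] at h1
  simpa [pow_mul] using h1

end Safra
end OmegaDet

-- Counting trees by bracket words

namespace OmegaDet

namespace STree

variable {N k : ℕ} {β : Type}

/-! ### Counting trees -/

/-- The letters of the bracket representation of trees. -/
abbrev Token (N : ℕ) (β : Type) := Option ((ℕ × β) ⊕ Fin N)

mutual
/-- The bracket representation of a tree. -/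
def encode : STree N β → List (Token N β)
  | node a d S cs => some (.inl (a, d)) ::
      ((S.sort (· ≤ ·)).map (fun q => some (.inr q)) ++ (encodeList cs ++ [none]))

def encodeList : List (STree N β) → List (Token N β)
  | [] => []
  | c :: cs => encode c ++ encodeList cs
end

theorem encode_states_cancel {l l' : List (Fin N)} {X X' : List (Token N β)}
    (hX : ∀ q, X.head? ≠ some (some (.inr q))) (hX' : ∀ q, X'.head? ≠ some (some (.inr q)))
    (h : l.map (fun q => some (.inr q)) ++ X = l'.map (fun q => some (.inr q)) ++ X') :
    l = l' ∧ X = X' := by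
  induction l generalizing l' with
  | nil =>
    cases l' with
    | nil => exact ⟨rfl, h⟩
    | cons q l' =>
      simp only [List.map_nil, List.nil_append] at h
      exact absurd (by rw [h]; rfl) (hX q)
  | cons q l ih =>
    cases l' with
    | nil =>
      simp only [List.map_nil, List.nil_append] at h
      exact absurd (by rw [← h]; rfl) (hX' q)
    | cons q' l' =>
      simp only [List.map_cons, List.cons_append, List.cons.injEq, Option.some.injEq,
        Sum.inr.injEq] at h
      obtain ⟨rfl, hXX⟩ := ih h.2
      exact ⟨by rw [h.1], hXX⟩

theorem head?_encodeList_append (cs : List (STree N β)) (r : List (Token N β)) (q : Fin N) :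
    (encodeList cs ++ none :: r).head? ≠ some (some (.inr q)) := by
  rcases cs with _ | ⟨⟨a, d, S, cs'⟩, cs⟩ <;> simp [encodeList, encode]

/-- Unique readability in the form that an induction can carry: arbitrary words may follow. A list
of children needs the closing bracket `none` behind it to show where it ends. -/
theorem encode_append_inj (t : STree N β) : ∀ (t' : STree N β) (r r' : List (Token N β)),
    encode t ++ r = encode t' ++ r' → t = t' ∧ r = r' := by
  refine STree.rec (motive_1 := fun t => ∀ (t' : STree N β) (r r' : List (Token N β)),
    encode t ++ r = encode t' ++ r' → t = t' ∧ r = r')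
    (motive_2 := fun cs => ∀ (cs' : List (STree N β)) (r r' : List (Token N β)),
      encodeList cs ++ none :: r = encodeList cs' ++ none :: r' → cs = cs' ∧ r = r')
    ?_ ?_ ?_ t
  · rintro a d S cs ih ⟨a', d', S', cs'⟩ r r' h
    simp only [encode, List.cons_append, List.append_assoc, List.cons.injEq, Option.some.injEq,
      Sum.inl.injEq, Prod.mk.injEq, List.nil_append] at h
    obtain ⟨⟨rfl, rfl⟩, h⟩ := h
    obtain ⟨hS, h⟩ := encode_states_cancel (head?_encodeList_append _ _)
      (head?_encodeList_append _ _) h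
    obtain ⟨rfl, rfl⟩ := ih _ _ _ h
    have := congrArg List.toFinset hS
    rw [Finset.sort_toFinset, Finset.sort_toFinset] at this
    exact ⟨by rw [this], rfl⟩
  · rintro (_ | ⟨⟨a, d, S, cs'⟩, cs⟩) r r' h
    · simpa [encodeList] using h
    · simp [encodeList, encode] at h
  · rintro c cs ihc ihcs (_ | ⟨c', cs'⟩) r r' h
    · cases c
      simp [encodeList, encode] at h
    · simp only [encodeList, List.append_assoc] at h
      obtain ⟨rfl, hcs⟩ := ihc _ _ _ h
      obtain ⟨rfl, rfl⟩ := ihcs _ _ _ hcs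
      exact ⟨rfl, rfl⟩

theorem encode_injective : Function.Injective (encode : STree N β → List (Token N β)) :=
  fun t t' h => (encode_append_inj t t' [] [] (by rw [h])).1

theorem mem_encodeList {cs : List (STree N β)} {x : Token N β} :
    x ∈ encodeList cs ↔ ∃ c ∈ cs, x ∈ encode c := by
  induction cs <;> simp_all [encodeList]

theorem mem_names_of_mem_encode {t : STree N β} {a : ℕ} {d : β}
    (h : some (.inl (a, d)) ∈ encode t) : a ∈ t.names := by
  induction t using induct with
  | h b d' S cs ih =>
    simp only [encode, List.mem_cons, Option.some.injEq, Sum.inl.injEq, Prod.mk.injEq,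
      List.mem_append, List.mem_map, reduceCtorEq, and_false, exists_false, false_or,
      List.not_mem_nil, or_false, mem_encodeList] at h
    rw [names, Finset.mem_insert, mem_namesList]
    rcases h with ⟨rfl, -⟩ | ⟨c, hc, h⟩
    · exact Or.inl rfl
    · exact Or.inr ⟨c, hc, ih c hc h⟩

theorem length_encodeList (cs : List (STree N β)) :
    (encodeList cs).length = (cs.map fun c => (encode c).length).sum := by
  induction cs <;> simp_all [encodeList]

theorem length_encode_node (a : ℕ) (d : β) (S : Finset (Fin N)) (cs : List (STree N β)) :
    (encode (node a d S cs)).length =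
      2 + S.card + (cs.map fun c => (encode c).length).sum := by
  simp only [encode, List.length_cons, List.length_append, List.length_map,
    Finset.length_sort, length_encodeList, List.length_nil]
  omega

theorem length_encode_le (t : STree N β) : (encode t).length ≤ size t * (2 + N) := by
  induction t using induct with
  | h a d S cs ih =>
    rw [length_encode_node, size, sizeList_eq, add_mul, one_mul, ← List.sum_map_mul_right]
    have h1 : S.card ≤ N := by simpa using Finset.card_le_univ S
    have h2 := List.sum_le_sum ih
    omega

/-- Words of length at most `l` are padded with `none` to functions on `Fin l`. -/
theorem finite_lists {γ : Type} [DecidableEq γ] (T : Finset γ) (l : ℕ) :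
    {x : List γ | x.length ≤ l ∧ ∀ y ∈ x, y ∈ T}.Finite ∧
      {x : List γ | x.length ≤ l ∧ ∀ y ∈ x, y ∈ T}.ncard ≤ (T.card + 1) ^ l := by
  classical
  let F : Finset (Fin l → Option γ) := Fintype.piFinset fun _ => Finset.insertNone T
  let g : List γ → Fin l → Option γ := fun x i => x[i.val]?
  have hmap : ∀ x ∈ {x : List γ | x.length ≤ l ∧ ∀ y ∈ x, y ∈ T}, g x ∈ (F : Set _) := by
    rintro x ⟨-, hx⟩
    simp only [F, Finset.mem_coe, Fintype.mem_piFinset, Finset.mem_insertNone, g]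
    intro i y hy
    exact hx y (List.mem_of_getElem? hy)
  have hinj : Set.InjOn g {x : List γ | x.length ≤ l ∧ ∀ y ∈ x, y ∈ T} := by
    rintro x ⟨hx, -⟩ y ⟨hy, -⟩ hxy
    refine List.ext_getElem? fun i => ?_
    by_cases hi : i < l
    · exact congrFun hxy ⟨i, hi⟩
    · rw [List.getElem?_eq_none (by omega), List.getElem?_eq_none (by omega)]
  refine ⟨Set.Finite.of_injOn hmap hinj F.finite_toSet, ?_⟩
  refine (Set.ncard_le_ncard_of_injOn g hmap hinj F.finite_toSet).trans ?_
  rw [Set.ncard_coe_finset]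
  simp [F]

theorem finite_encode [Fintype β] [DecidableEq β] (B l : ℕ) :
    {t : STree N β | (encode t).length ≤ l ∧ ∀ a ∈ t.names, a ≤ B}.Finite ∧
      {t : STree N β | (encode t).length ≤ l ∧ ∀ a ∈ t.names, a ≤ B}.ncard ≤
        ((B + 1) * Fintype.card β + N + 2) ^ l := by
  let T : Finset (Token N β) := Finset.insertNone
    ((Finset.range (B + 1) ×ˢ Finset.univ).disjSum Finset.univ)
  have hT : T.card + 1 = (B + 1) * Fintype.card β + N + 2 := by
    simp [T, Finset.card_disjSum]
  have hmap : ∀ t ∈ {t : STree N β | (encode t).length ≤ l ∧ ∀ a ∈ t.names, a ≤ B},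
      encode t ∈ {x : List (Token N β) | x.length ≤ l ∧ ∀ y ∈ x, y ∈ T} := by
    rintro t ⟨h1, h2⟩
    refine ⟨h1, fun y hy => ?_⟩
    rcases y with _ | ⟨a, d⟩ | q
    · simp [T]
    · simp [T, h2 a (mem_names_of_mem_encode hy)]
    · simp [T]
  obtain ⟨h1, h2⟩ := finite_lists T l
  rw [hT] at h2
  exact ⟨Set.Finite.of_injOn hmap encode_injective.injOn h1,
    (Set.ncard_le_ncard_of_injOn encode hmap encode_injective.injOn h1).trans h2⟩

end STree

/-! ### Compaction of names -/

section Compact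

open STree

variable {N : ℕ} {β : Type}

theorem compact_e_le (m : ℕ) (t : STree N β) (L : Log) : (compact m t L).e ≤ m + 1 :=
  (Finset.fold_min_le (m + 1)).2 (Or.inl le_rfl)

theorem compact_f_le (m : ℕ) (t : STree N β) (L : Log) : (compact m t L).f ≤ m + 1 :=
  (Finset.fold_min_le (m + 1)).2 (Or.inl le_rfl)

theorem exists_compact_tree (m : ℕ) (t : STree N β) (L : Log) :
    ∃ g, (compact m t L).tree = t.mapNodes g id := ⟨_, rfl⟩

/-- When the used names form an initial segment, subtracting the number of smaller removed names
gives the rank of a name among the surviving ones. -/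
theorem names_compact {m M : ℕ} {t : STree N β} {L : Log} (hL : L.used = Finset.Icc 1 M)
    (ht : t.names ⊆ L.used) :
    (compact m t L).tree.names = Finset.Icc 1 t.names.card := by
  have hrank : ∀ a ∈ t.names,
      a - ((L.used \ t.names).filter (· < a)).card = (t.names.filter (· ≤ a)).card := by
    intro a ha
    have haM := Finset.mem_Icc.1 (hL ▸ ht ha)
    have hu : Finset.Icc 1 a =
        t.names.filter (· ≤ a) ∪ (L.used \ t.names).filter (· < a) := by
      ext x
      simp only [Finset.mem_Icc, Finset.mem_union, Finset.mem_filter, Finset.mem_sdiff, hL]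
      constructor
      · intro hx
        by_cases hxt : x ∈ t.names
        · exact Or.inl ⟨hxt, hx.2⟩
        · have : x ≠ a := fun h => hxt (h ▸ ha)
          exact Or.inr ⟨⟨⟨hx.1, by omega⟩, hxt⟩, by omega⟩
      · rintro (⟨hx, hxa⟩ | ⟨⟨hx, -⟩, hxa⟩)
        · exact ⟨(Finset.mem_Icc.1 (hL ▸ ht hx)).1, hxa⟩
        · exact ⟨hx.1, hxa.le⟩
    have hc := congrArg Finset.card hu
    rw [Finset.card_union_of_disjoint, Nat.card_Icc] at hc
    · omega
    · rw [Finset.disjoint_left]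
      intro x hx hx'
      simp only [Finset.mem_filter, Finset.mem_sdiff] at hx hx'
      exact hx'.1.2 hx.1
  have himg : (compact m t L).tree.names =
      t.names.image fun a => (t.names.filter (· ≤ a)).card := by
    simp only [compact, names_mapNodes]
    exact Finset.image_congr hrank
  rw [himg]
  refine Finset.eq_of_subset_of_card_le ?_ ?_
  · intro x hx
    obtain ⟨a, ha, rfl⟩ := Finset.mem_image.1 hx
    exact Finset.mem_Icc.2 ⟨Finset.card_pos.2 ⟨a, by simp [ha]⟩,
      Finset.card_le_card (Finset.filter_subset _ _)⟩
  · rw [Finset.card_image_of_injOn, Nat.card_Icc, Nat.add_sub_cancel]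
    have hlt : ∀ a ∈ t.names, ∀ b ∈ t.names, a < b →
        (t.names.filter (· ≤ a)).card < (t.names.filter (· ≤ b)).card := by
      intro a ha b hb hab
      refine Finset.card_lt_card ((Finset.ssubset_iff_of_subset fun x hx => ?_).2 ⟨b, ?_, ?_⟩)
      · rw [Finset.mem_filter] at hx ⊢
        exact ⟨hx.1, hx.2.trans hab.le⟩
      · simp [hb]
      · simp [hab]
    intro a ha b hb h
    rcases lt_trichotomy a b with hab | hab | hab
    · exact absurd h (hlt a ha b hb hab).ne
    · exact hab
    · exact absurd h (hlt b hb a ha hab).ne'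

theorem finite_markedTree {T : Set (STree N β)} (hT : T.Finite) (m : ℕ) :
    {s : MarkedTree N β | s.tree ∈ T ∧ s.e ≤ m ∧ s.f ≤ m}.Finite ∧
      {s : MarkedTree N β | s.tree ∈ T ∧ s.e ≤ m ∧ s.f ≤ m}.ncard ≤
        T.ncard * ((m + 1) * (m + 1)) := by
  let g : MarkedTree N β → STree N β × ℕ × ℕ := fun s => (s.tree, s.e, s.f)
  have hmap : ∀ s ∈ {s : MarkedTree N β | s.tree ∈ T ∧ s.e ≤ m ∧ s.f ≤ m},
      g s ∈ T ×ˢ (Set.Iic m ×ˢ Set.Iic m) := fun s hs => hs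
  have hinj : Function.Injective g := by
    rintro ⟨t, e, f⟩ ⟨t', e', f'⟩ h
    simpa [g] using h
  have hfin : (T ×ˢ ((Set.Iic m : Set ℕ) ×ˢ (Set.Iic m : Set ℕ))).Finite :=
    hT.prod ((Set.finite_Iic m).prod (Set.finite_Iic m))
  refine ⟨Set.Finite.of_injOn hmap hinj.injOn hfin,
    (Set.ncard_le_ncard_of_injOn g hmap hinj.injOn hfin).trans ?_⟩
  have hm : (Set.Iic m : Set ℕ).ncard = m + 1 := by
    rw [← Finset.coe_Iic, Set.ncard_coe_finset, Nat.card_Iic]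
  rw [Set.ncard_prod, Set.ncard_prod, hm]

end Compact

-- The uniform construction: depth, size and number of trees

namespace Uniform

open STree

variable {α : Type} {N : ℕ}

theorem max_sdiff_dropAnn {h : Finset (Fin N)} {x : WithBot (Fin N)}
    (hx : x = ⊥ ∨ ∃ j ∈ h, x = j) : (h \ dropAnn h x).max = x := by
  rcases hx with rfl | ⟨j, hj, rfl⟩
  · simp
  · rw [dropAnn_coe, Finset.sdiff_erase hj, sdiff_self]
    simp

theorem edgeAnn_eq_bot_or (h : Finset (Fin N)) (c : HopeTree N) :
    edgeAnn h c = ⊥ ∨ ∃ j ∈ h, edgeAnn h c = j := by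
  rcases hm : edgeAnn h c with _ | j
  · exact Or.inl rfl
  · exact Or.inr ⟨j, (Finset.mem_sdiff.1 (Finset.mem_of_max hm)).1, rfl⟩

/-- The hope set of a node is that of its parent, or lacks one element of it; the state label
of a node is contained in that of its parent. -/
inductive WellFormed : HopeTree N → Prop
  | node (a : ℕ) (h S : Finset (Fin N)) (cs : List (HopeTree N))
      (hd : ∀ c ∈ cs, c.deco = dropAnn h (edgeAnn h c)) (hS : ∀ c ∈ cs, c.label ⊆ S)
      (hc : ∀ c ∈ cs, WellFormed c) : WellFormed (node a h S cs)

theorem wellFormed_node {a : ℕ} {h S : Finset (Fin N)} {cs : List (HopeTree N)} :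
    WellFormed (node a h S cs) ↔ (∀ c ∈ cs, c.deco = dropAnn h (edgeAnn h c)) ∧
      (∀ c ∈ cs, c.label ⊆ S) ∧ ∀ c ∈ cs, WellFormed c :=
  ⟨fun h => by cases h with | node _ _ _ _ hd hS hc => exact ⟨hd, hS, hc⟩,
    fun h => .node _ _ _ _ h.1 h.2.1 h.2.2⟩

theorem WellFormed.nested {t : HopeTree N} (h : WellFormed t) : Nested label t := by
  induction h with
  | node a h S cs _ hS _ ih => exact .node _ _ _ _ ih hS

@[simp] theorem edgeAnn_mapNodes (f : ℕ → ℕ) (g : Finset (Fin N) → Finset (Fin N))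
    (h : Finset (Fin N)) (t : HopeTree N) : edgeAnn h (mapNodes f g t) = edgeAnn h t := by
  simp [edgeAnn]

@[simp] theorem edgeAnn_remove (R : Finset (Fin N)) (h : Finset (Fin N)) (t : HopeTree N) :
    edgeAnn h (t.remove R) = edgeAnn h t := by
  simp [edgeAnn]

@[simp] theorem edgeAnn_prune (lam : HopeTree N → Finset (Fin N)) (h : Finset (Fin N))
    (t : HopeTree N) : edgeAnn h (prune lam t) = edgeAnn h t := by
  simp [edgeAnn]

theorem WellFormed.mapNodes (f : ℕ → ℕ) {g : Finset (Fin N) → Finset (Fin N)}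
    (hg : Monotone g) {t : HopeTree N} (h : WellFormed t) : WellFormed (mapNodes f g t) := by
  induction t using induct with
  | h a d S cs ih =>
    rw [wellFormed_node] at h
    rw [mapNodes_node, wellFormed_node]
    simp only [List.mem_map, forall_exists_index, and_imp, forall_apply_eq_imp_iff₂,
      deco_mapNodes, edgeAnn_mapNodes, label_mapNodes]
    exact ⟨h.1, fun c hc => hg (h.2.1 c hc), fun c hc => ih c hc (h.2.2 c hc)⟩

theorem WellFormed.remove (R : Finset (Fin N)) {t : HopeTree N} (h : WellFormed t) :
    WellFormed (t.remove R) :=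
  h.mapNodes _ fun _ _ hST => Finset.sdiff_subset_sdiff hST subset_rfl

theorem WellFormed.prune (lam : HopeTree N → Finset (Fin N)) {t : HopeTree N}
    (h : WellFormed t) : WellFormed (prune lam t) := by
  induction t using induct with
  | h a d S cs ih =>
    rw [wellFormed_node] at h
    rw [prune_node, wellFormed_node]
    have : ∀ c' ∈ (cs.filter fun c => lam c ≠ ∅).map (STree.prune lam),
        ∃ c ∈ cs, c' = STree.prune lam c := by
      intro c' hc'
      obtain ⟨c, hc, rfl⟩ := List.mem_map.1 hc'
      exact ⟨c, (List.mem_filter.1 hc).1, rfl⟩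
    refine ⟨fun c' hc' => ?_, fun c' hc' => ?_, fun c' hc' => ?_⟩ <;>
      obtain ⟨c, hc, rfl⟩ := this c' hc'
    · simpa using h.1 c hc
    · simpa using h.2.1 c hc
    · exact ih c hc (h.2.2 c hc)

theorem mem_newChildren {h : Finset (Fin N)} {c : HopeTree N}
    {x : Finset (Fin N) × Finset (Fin N)} :
    x ∈ newChildren h c ↔ ∃ q ∈ c.label, (q : WithBot (Fin N)) = edgeAnn h c ∧
      x = (dropAnn h (predAnn h (edgeAnn h c)), {q}) := by
  simp only [newChildren, List.mem_flatMap, Finset.mem_sort]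
  refine exists_congr fun q => and_congr_right fun _ => ?_
  split_ifs <;> simp_all

/-- The children of a node before separation. -/
def pieces (h : Finset (Fin N)) (cs : List (HopeTree N)) (L : Log) : List (HopeTree N) :=
  cs.map (fun c => c.remove (outside h c)) ++
    (spawn nextName L.used (cs.flatMap (newChildren h))).1

/-- The children of a node after separation. -/
def settled (h : Finset (Fin N)) (cs : List (HopeTree N)) (L : Log) : List (HopeTree N) :=
  settle (edgeAnn h) label (pieces h cs L)

theorem of_mem_pieces {h : Finset (Fin N)} {cs : List (HopeTree N)} {L : Log} {c : HopeTree N}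
    (hc : c ∈ pieces h cs L) :
    (∃ x ∈ cs, c = x.remove (outside h x)) ∨
    ∃ x ∈ cs, ∃ q ∈ x.label, ∃ a, (q : WithBot (Fin N)) = edgeAnn h x ∧
      c = node a (dropAnn h (predAnn h (edgeAnn h x))) {q} [] := by
  rcases List.mem_append.1 hc with hc | hc
  · obtain ⟨x, hx, rfl⟩ := List.mem_map.1 hc
    exact Or.inl ⟨x, hx, rfl⟩
  · obtain ⟨a, y, hy, rfl⟩ := of_mem_spawn hc
    obtain ⟨x, hx, hy⟩ := List.mem_flatMap.1 hy
    obtain ⟨q, hq, hqx, rfl⟩ := mem_newChildren.1 hy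
    exact Or.inr ⟨x, hx, q, hq, a, hqx, rfl⟩

theorem mem_of_coe_eq_edgeAnn {h : Finset (Fin N)} {c : HopeTree N} {q : Fin N}
    (hq : (q : WithBot (Fin N)) = edgeAnn h c) : q ∈ h :=
  (Finset.mem_sdiff.1 (Finset.mem_of_max hq.symm)).1

theorem dropAnn_subset (h : Finset (Fin N)) (x : WithBot (Fin N)) : dropAnn h x ⊆ h :=
  Finset.filter_subset _ _

/-- The bound by `h` holds because a state survives only if it annotates the edge or lies in the
child's hope set, and both are inside `h`. It drives the depth bound for children annotated `⊥`. -/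
theorem pieces_spec {h S : Finset (Fin N)} {cs : List (HopeTree N)} {L : Log}
    (hd : ∀ c ∈ cs, c.deco = dropAnn h (edgeAnn h c)) (hS : ∀ c ∈ cs, c.label ⊆ S)
    {c : HopeTree N} (hc : c ∈ pieces h cs L) :
    c.deco = dropAnn h (edgeAnn h c) ∧ c.label ⊆ S ∧ c.label ⊆ h := by
  rcases of_mem_pieces hc with ⟨x, hx, rfl⟩ | ⟨x, hx, q, hq, a, hqx, rfl⟩
  · rw [deco_remove, edgeAnn_remove, label_remove]
    refine ⟨hd x hx, Finset.sdiff_subset.trans (hS x hx), fun q hq => ?_⟩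
    simp only [outside, Finset.mem_sdiff, Finset.mem_filter, not_and, not_not] at hq
    by_cases hqx : (q : WithBot (Fin N)) = edgeAnn h x
    · exact mem_of_coe_eq_edgeAnn hqx
    · have := hq.2 hq.1 hqx
      rw [hd x hx] at this
      exact dropAnn_subset _ _ this
  · refine ⟨?_, ?_, ?_⟩
    · simp only [edgeAnn, deco]
      rw [max_sdiff_dropAnn (predAnn_eq_bot_or _ _)]
    · simpa [label] using hS x hx hq
    · simpa [label] using mem_of_coe_eq_edgeAnn hqx

theorem finish_fst (A : OmegaAut α N) (a : ℕ) (h S : Finset (Fin N)) (cs : List (HopeTree N))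
    (L : Log) : (finish A a h S cs L).1 =
      if ∀ c ∈ settled h cs L, c.deco = h then node a h S [] else node a h S (settled h cs L) := by
  simp only [finish]
  change (if ∀ c ∈ settled h cs L, c.deco = h then _ else _ : HopeTree N × Log).1 = _
  split_ifs <;> rfl

theorem deco_finish (A : OmegaAut α N) (a : ℕ) (h S : Finset (Fin N)) (cs : List (HopeTree N))
    (L : Log) : (finish A a h S cs L).1.deco = h := by
  rw [finish_fst]
  split_ifs <;> rfl

theorem label_finish (A : OmegaAut α N) (a : ℕ) (h S : Finset (Fin N)) (cs : List (HopeTree N))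
    (L : Log) : (finish A a h S cs L).1.label = S := by
  rw [finish_fst]
  split_ifs <;> rfl

/-- The properties of the trees that the recursive procedure returns. -/
structure Settled (t : HopeTree N) : Prop where
  wellFormed : WellFormed t
  separated : Separated label t
  reduced : Reduced label t
  depth_le : depth t ≤ t.label.card + t.deco.card

theorem settled_leaf (a : ℕ) (h S : Finset (Fin N)) : Settled (node a h S [] : HopeTree N) := by
  refine ⟨?_, ?_, ?_, ?_⟩
  · simp [wellFormed_node]
  · simp [separated_node]
  · simp [reduced_node]
  · simp [depth, depthList]

/-- The potential is now `|label| + |hope set|`. A nonzero annotation costs an element of the hope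
set, and the annotation `⊥` costs a state of the label. -/
theorem settled_finish (A : OmegaAut α N) (a : ℕ) (h S : Finset (Fin N))
    (cs : List (HopeTree N)) (L : Log)
    (hd : ∀ c ∈ cs, c.deco = dropAnn h (edgeAnn h c)) (hS : ∀ c ∈ cs, c.label ⊆ S)
    (hc : ∀ c ∈ cs, Settled c) : Settled (finish A a h S cs L).1 := by
  rw [finish_fst]
  split_ifs with hbot
  · exact settled_leaf _ _ _
  push Not at hbot
  have hset : ∀ c ∈ settled h cs L, c.deco = dropAnn h (edgeAnn h c) ∧ c.label ⊆ S ∧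
      WellFormed c := by
    intro c hcs
    obtain ⟨x, hx, R, rfl, -⟩ := of_mem_settle isLabelling_label hcs
    have hsp := pieces_spec hd hS hx
    rw [deco_prune, deco_remove, edgeAnn_prune, edgeAnn_remove, label_prune, label_remove]
    refine ⟨hsp.1, Finset.sdiff_subset.trans hsp.2.1, WellFormed.prune _ (WellFormed.remove _ ?_)⟩
    rcases of_mem_pieces hx with ⟨y, hy, rfl⟩ | ⟨y, hy, q, hq, a, hqy, rfl⟩
    · exact (hc y hy).wellFormed.remove _
    · exact (settled_leaf _ _ _).wellFormed
  refine ⟨wellFormed_node.2 ⟨fun c h => (hset c h).1, fun c h => (hset c h).2.1,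
    fun c h => (hset c h).2.2⟩,
    separated_node.2 ⟨?_, settle_pairwise isLabelling_label _⟩, reduced_node.2 ?_, ?_⟩
  · refine settle_separated isLabelling_label fun c h => ?_
    rcases of_mem_pieces h with ⟨x, hx, rfl⟩ | ⟨x, hx, q, hq, a, hqx, rfl⟩
    · exact (hc x hx).separated.remove isLabelling_label _
    · exact (settled_leaf _ _ _).separated
  · have := settle_reduced (ann := edgeAnn h) isLabelling_label (pieces h cs L)
    exact ⟨fun c h => (this c h).1, fun c h => (this c h).2⟩
  · rw [depth_node_le]
    refine settle_depth_le isLabelling_label (fun R t => edgeAnn_remove R h t)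
      (fun t => edgeAnn_prune _ h t) ?_ ?_ ?_
    · intro c hcp hb
      rcases of_mem_pieces hcp with ⟨x, hx, rfl⟩ | ⟨x, hx, q, hq, a, hqx, rfl⟩
      · rw [edgeAnn_remove] at hb
        obtain ⟨j, hj, hxj⟩ := (edgeAnn_eq_bot_or h x).resolve_left hb
        have h1 := (hc x hx).depth_le
        have h2 := Finset.card_le_card (hS x hx)
        have h3 : depth (x.remove (outside h x)) ≤ depth x := depth_mapNodes_le _ _ _
        have h4 := Finset.card_erase_add_one hj
        rw [hd x hx, hxj, dropAnn_coe] at h1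
        simp only [label, deco]
        omega
      · have := Finset.card_pos.2 ⟨q, hS x hx hq⟩
        simp only [depth, depthList, label]
        omega
    · intro c hcp hb w hw hwb q hqw hqc
      have hqS := (pieces_spec hd hS hw).2.1 hqw
      have hqh := (pieces_spec hd hS hw).2.2 hqw
      rcases of_mem_pieces hcp with ⟨x, hx, rfl⟩ | ⟨x, hx, p, hp, a, hqx, rfl⟩
      · rw [edgeAnn_remove] at hb
        have hdx := hd x hx
        rw [hb, dropAnn_bot] at hdx
        -- With annotation `⊥` the child's hope set is `h`, which contains `q`; so `q` was not
        -- removed as an outside state and must have been absent from the start.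
        have hqx : q ∉ x.label := by
          intro hqx
          rw [label_remove, Finset.mem_sdiff, not_and, not_not] at hqc
          have := (Finset.mem_filter.1 (hqc hqx)).2.2
          rw [hdx] at this
          exact this hqh
        have h1 := (hc x hx).depth_le
        have h2 := Finset.card_lt_card
          ((Finset.ssubset_iff_of_subset (hS x hx)).2 ⟨q, hqS, hqx⟩)
        have h3 : depth (x.remove (outside h x)) ≤ depth x := depth_mapNodes_le _ _ _
        rw [hdx] at h1
        simp only [label, deco]
        omega
      · have := Finset.card_pos.2 ⟨q, hqS⟩
        simp only [depth, depthList, label]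
        omega
    · obtain ⟨c, hcs, hne⟩ := hbot
      refine ⟨c, hcs, fun hb => hne ?_⟩
      rw [(hset c hcs).1, hb, dropAnn_bot]

theorem recLeaf_good (A : OmegaAut α N) (b a : ℕ) (h S : Finset (Fin N)) (L : Log) :
    (recLeaf A b a h S L).1.deco = h ∧ (recLeaf A b a h S L).1.label = S ∧
      Settled (recLeaf A b a h S L).1 := by
  induction b generalizing a h L with
  | zero => exact ⟨rfl, rfl, settled_leaf _ _ _⟩
  | succ b ih =>
    have hr := ih (nextName L.used) (dropAnn h h.max) ⟨insert (nextName L.used) L.used, L.succ⟩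
    rw [recLeaf]
    refine ⟨deco_finish _ _ _ _ _ _, label_finish _ _ _ _ _ _, settled_finish _ _ _ _ _ _ ?_ ?_ ?_⟩
    · simp only [List.mem_singleton, forall_eq, edgeAnn]
      rw [hr.1, max_sdiff_dropAnn]
      rcases hm : h.max with _ | j
      · exact Or.inl rfl
      · exact Or.inr ⟨j, Finset.mem_of_max hm, rfl⟩
    · simp only [List.mem_singleton, forall_eq]
      rw [hr.2.1]
    · simp only [List.mem_singleton, forall_eq]
      exact hr.2.2

theorem recList_forall₂ (A : OmegaAut α N) (cs : List (HopeTree N)) (L : Log) :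
    List.Forall₂ (fun c r => ∃ L', r = (recTree A c L').1) cs (recList A cs L).1 := by
  induction cs generalizing L with
  | nil => simp [recList]
  | cons c cs ih =>
    rw [recList]
    exact .cons ⟨L, rfl⟩ (ih _)

theorem recTree_node {A : OmegaAut α N} {a : ℕ} {h S : Finset (Fin N)} {cs : List (HopeTree N)}
    {L : Log} (hcs : cs ≠ []) : recTree A (node a h S cs) L =
      finish A a h S (recList A cs L).1 (recList A cs L).2 := by
  cases cs with
  | nil => exact absurd rfl hcs
  | cons c cs => simp only [recTree, recList]

theorem deco_recTree (A : OmegaAut α N) (t : HopeTree N) (L : Log) :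
    (recTree A t L).1.deco = t.deco := by
  rcases t with ⟨a, d, S, _ | ⟨c, cs⟩⟩
  · exact (recLeaf_good _ _ _ _ _ _).1
  · exact deco_finish _ _ _ _ _ _

theorem label_recTree (A : OmegaAut α N) (t : HopeTree N) (L : Log) :
    (recTree A t L).1.label = t.label := by
  rcases t with ⟨a, d, S, _ | ⟨c, cs⟩⟩
  · exact (recLeaf_good _ _ _ _ _ _).2.1
  · exact label_finish _ _ _ _ _ _

theorem settled_recTree (A : OmegaAut α N) {t : HopeTree N} (L : Log) (ht : WellFormed t) :
    Settled (recTree A t L).1 := by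
  induction t using induct generalizing L with
  | h a d S cs ih =>
    by_cases h : cs = []
    · subst h
      rw [recTree]
      exact (recLeaf_good _ _ _ _ _ _).2.2
    · rw [wellFormed_node] at ht
      rw [recTree_node h]
      have hf := recList_forall₂ A cs L
      refine settled_finish _ _ _ _ _ _ ?_ ?_ ?_ <;> intro r hr <;>
        obtain ⟨c, hc, L', rfl⟩ := Safra.forall₂_mem_right hf hr
      · rw [edgeAnn, deco_recTree]
        exact ht.1 c hc
      · rw [label_recTree]
        exact ht.2.1 c hc
      · exact ih c hc L' (ht.2.2 c hc)

/-! ### Names -/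

theorem finish_names (A : OmegaAut α N) (a : ℕ) (h S : Finset (Fin N))
    (cs : List (HopeTree N)) (L : Log) (ha : a ∈ L.used) (hc : ∀ c ∈ cs, c.names ⊆ L.used) :
    Extends nextName L.used (finish A a h S cs L).2.used ∧
      (finish A a h S cs L).1.names ⊆ (finish A a h S cs L).2.used := by
  have hE := spawn_extends nextName (cs.flatMap (newChildren h)) L.used
  have hu : (finish A a h S cs L).2.used =
      (spawn nextName L.used (cs.flatMap (newChildren h))).2 := by
    simp only [finish]
    split_ifs <;> rfl
  rw [hu]
  refine ⟨hE, ?_⟩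
  rw [finish_fst]
  split_ifs
  · simpa [names, namesList] using hE.subset ha
  · refine Finset.insert_subset (hE.subset ha) ?_
    refine namesList_settle_subset isLabelling_label fun c h => ?_
    rcases List.mem_append.1 h with h | h
    · obtain ⟨x, hx, rfl⟩ := List.mem_map.1 h
      rw [names_remove]
      exact (hc x hx).trans hE.subset
    · exact names_spawn_subset _ _ _ c h

theorem recLeaf_names (A : OmegaAut α N) (b a : ℕ) (h S : Finset (Fin N)) (L : Log)
    (ha : a ∈ L.used) :
    Extends nextName L.used (recLeaf A b a h S L).2.used ∧
      (recLeaf A b a h S L).1.names ⊆ (recLeaf A b a h S L).2.used := by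
  induction b generalizing a h L with
  | zero =>
    rw [recLeaf]
    exact ⟨.refl, by simpa [names, namesList] using ha⟩
  | succ b ih =>
    have h' := ih (nextName L.used) (dropAnn h h.max) ⟨insert (nextName L.used) L.used, L.succ⟩
      (Finset.mem_insert_self _ _)
    have h1 : Extends nextName L.used (insert (nextName L.used) L.used) := .step .refl
    rw [recLeaf]
    have h2 := finish_names A a h S [(recLeaf A b (nextName L.used) (dropAnn h h.max) S
      ⟨insert (nextName L.used) L.used, L.succ⟩).1] _ ((h1.trans h'.1).subset ha)
      (by simpa using h'.2)
    exact ⟨(h1.trans h'.1).trans h2.1, h2.2⟩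

theorem recTree_names (A : OmegaAut α N) (t : HopeTree N) (L : Log) (ht : t.names ⊆ L.used) :
    Extends nextName L.used (recTree A t L).2.used ∧
      (recTree A t L).1.names ⊆ (recTree A t L).2.used := by
  induction t using induct generalizing L with
  | h a d S cs ih =>
    rw [names, Finset.insert_subset_iff] at ht
    have hl : ∀ (l : List (HopeTree N)) (L : Log), (∀ c ∈ l, c ∈ cs) → namesList l ⊆ L.used →
        Extends nextName L.used (recList A l L).2.used ∧
          ∀ c ∈ (recList A l L).1, c.names ⊆ (recList A l L).2.used := by
      intro l
      induction l with
      | nil => exact fun L _ _ => ⟨by rw [recList]; exact .refl, by simp [recList]⟩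
      | cons c l ihl =>
        intro L hm hn
        rw [namesList, Finset.union_subset_iff] at hn
        have h1 := ih c (hm c (by simp)) L hn.1
        have h2 := ihl (recTree A c L).2
          (fun x hx => hm x (by simp [hx])) (hn.2.trans h1.1.subset)
        rw [recList]
        refine ⟨h1.1.trans h2.1, ?_⟩
        simp only [List.mem_cons, forall_eq_or_imp]
        exact ⟨h1.2.trans h2.1.subset, h2.2⟩
    by_cases h : cs = []
    · subst h
      rw [recTree]
      exact recLeaf_names _ _ _ _ _ _ ht.1
    · have h1 := hl cs L (fun _ h => h) ht.2
      rw [recTree_node h]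
      have h2 := finish_names A a d S _ _ (h1.1.subset ht.1) h1.2
      exact ⟨h1.1.trans h2.1, h2.2⟩

/-! ### Counting -/

/-- The states of `S` that belong to the label of no tree in `cs`. -/
def ownStates (S : Finset (Fin N)) (cs : List (HopeTree N)) : Finset (Fin N) :=
  S.filter fun q => ∀ c ∈ cs, q ∉ c.label

theorem mem_ownStates {S : Finset (Fin N)} {cs : List (HopeTree N)} {q : Fin N} :
    q ∈ ownStates S cs ↔ q ∈ S ∧ ∀ c ∈ cs, q ∉ c.label := by
  simp [ownStates]

mutual
/-- Hope sets are replaced by edge annotations, where `h` is the hope set of the parent of the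
root, and every state is kept only in the label of the deepest nodes that contain it. -/
def compress (h : Finset (Fin N)) : HopeTree N → STree N (WithBot (Fin N))
  | node a d S cs => node a (h \ d).max (ownStates S cs) (compressList d cs)

def compressList (h : Finset (Fin N)) : List (HopeTree N) → List (STree N (WithBot (Fin N)))
  | [] => []
  | c :: cs => compress h c :: compressList h cs
end

theorem compressList_eq (h : Finset (Fin N)) (cs : List (HopeTree N)) :
    compressList h cs = cs.map (compress h) := by
  induction cs <;> simp_all [compressList]

theorem compress_node (h : Finset (Fin N)) (a : ℕ) (d S : Finset (Fin N))
    (cs : List (HopeTree N)) : compress h (node a d S cs) =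
      node a (h \ d).max (ownStates S cs) (cs.map (compress d)) := by
  rw [compress, compressList_eq]

theorem eq_of_map_eq_map {γ δ : Type} {f : γ → δ} {l l' : List γ}
    (hf : ∀ x ∈ l, ∀ y ∈ l', f x = f y → x = y) (h : l.map f = l'.map f) : l = l' := by
  induction l generalizing l' with
  | nil => simpa using h.symm
  | cons x l ih =>
    cases l' with
    | nil => simp at h
    | cons y l' =>
      simp only [List.map_cons, List.cons.injEq] at h
      rw [hf x (by simp) y (by simp) h.1,
        ih (fun x hx y hy => hf x (by simp [hx]) y (by simp [hy])) h.2]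

/-- Hope sets are recovered downwards from the annotations, labels upwards: a label is its own
states together with the labels of the children. -/
theorem compress_inj {h : Finset (Fin N)} {t t' : HopeTree N} (ht : WellFormed t)
    (ht' : WellFormed t') (hd : t.deco = dropAnn h (edgeAnn h t))
    (hd' : t'.deco = dropAnn h (edgeAnn h t')) (he : compress h t = compress h t') : t = t' := by
  induction t using induct generalizing h t' with
  | h a d S cs ih =>
    obtain ⟨a', d', S', cs'⟩ := t'
    rw [compress_node, compress_node, node.injEq] at he
    obtain ⟨rfl, hdd, hSS, hcs⟩ := he
    simp only [edgeAnn, deco] at hd hd'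
    rw [hdd, ← hd'] at hd
    subst hd
    rw [wellFormed_node] at ht ht'
    obtain rfl : cs = cs' := eq_of_map_eq_map (fun x hx y hy hxy =>
      ih x hx (ht.2.2 x hx) (ht'.2.2 y hy) (ht.1 x hx) (ht'.1 y hy) hxy) hcs
    obtain rfl : S = S' := by
      ext q
      by_cases hq : ∃ c ∈ cs, q ∈ c.label
      · obtain ⟨c, hc, hq⟩ := hq
        exact ⟨fun _ => ht'.2.1 c hc hq, fun _ => ht.2.1 c hc hq⟩
      · push Not at hq
        have := Finset.ext_iff.1 hSS q
        rw [mem_ownStates, mem_ownStates, and_iff_left hq, and_iff_left hq] at this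
        exact this
    rfl

theorem names_compress (h : Finset (Fin N)) (t : HopeTree N) :
    (compress h t).names = t.names := by
  induction t using induct generalizing h with
  | h a d S cs ih =>
    rw [compress_node, names, names]
    congr 1
    ext x
    rw [mem_namesList, mem_namesList]
    constructor
    · rintro ⟨y, hy, hx⟩
      obtain ⟨c, hc, rfl⟩ := List.mem_map.1 hy
      exact ⟨c, hc, by rwa [ih c hc] at hx⟩
    · rintro ⟨c, hc, hx⟩
      exact ⟨_, List.mem_map_of_mem hc, by rwa [ih c hc]⟩

/-- Two brackets per node. Each state is written once, at the bottom of the chain of nodes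
containing it, since siblings are disjoint. -/
theorem length_encode_compress_le {h : Finset (Fin N)} {t : HopeTree N} (ht : WellFormed t)
    (hs : Separated label t) : (encode (compress h t)).length ≤ 2 * size t + t.label.card := by
  induction t using induct generalizing h with
  | h a d S cs ih =>
    rw [wellFormed_node] at ht
    rw [separated_node] at hs
    rw [compress_node, length_encode_node, size, sizeList_eq, List.map_map]
    have h1 : (cs.map ((fun c => (encode c).length) ∘ compress d)).sum ≤
        (cs.map fun c => 2 * size c + c.label.card).sum :=
      List.sum_le_sum fun c hc => ih c hc (ht.2.2 c hc) (hs.1 c hc)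
    rw [List.sum_map_add, List.sum_map_mul_left] at h1
    have h2 := sum_card_le label cs (S \ ownStates S cs) hs.2 (by
      intro c hc q hq
      rw [Finset.mem_sdiff, mem_ownStates]
      exact ⟨ht.2.1 c hc hq, fun h => h.2 c hc hq⟩)
    have hsub : ownStates S cs ⊆ S := Finset.filter_subset _ S
    have h3 := Finset.card_sdiff_add_card_eq_card hsub
    change _ ≤ _ + S.card
    omega

/-- The trees that occur in the states of the uniform construction. -/
structure StateTree (t : HopeTree N) : Prop where
  wellFormed : WellFormed t
  separated : Separated label t
  deco : t.deco = Finset.univ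
  size_le : size t ≤ 1 + N * (N + N)
  names : ∃ M, t.names = Finset.Icc 1 M

theorem StateTree.names_le {t : HopeTree N} (h : StateTree t) :
    ∀ a ∈ t.names, a ≤ 1 + N * (N + N) := by
  obtain ⟨M, hM⟩ := h.names
  intro a ha
  have h1 := card_names_le_size t
  rw [hM, Nat.card_Icc] at h1
  rw [hM, Finset.mem_Icc] at ha
  have := h.size_le
  omega

/-- The alphabet stays polynomial because a node carries one of `N + 1` annotations in place of one
of `2 ^ N` hope sets, and names are bounded by the number of nodes. -/
theorem card_stateTree_le :
    {t : HopeTree N | StateTree t}.Finite ∧ {t : HopeTree N | StateTree t}.ncard ≤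
      ((1 + N * (N + N) + 1) * (N + 1) + N + 2) ^ (2 * (1 + N * (N + N)) + N) := by
  obtain ⟨h1, h2⟩ := finite_encode (N := N) (β := WithBot (Fin N)) (1 + N * (N + N))
    (2 * (1 + N * (N + N)) + N)
  have hc : Fintype.card (WithBot (Fin N)) = N + 1 := by
    rw [show Fintype.card (WithBot (Fin N)) = Fintype.card (Option (Fin N)) from rfl]
    simp
  rw [hc] at h2
  have hmap : ∀ t ∈ {t : HopeTree N | StateTree t}, compress Finset.univ t ∈
      {t : STree N (WithBot (Fin N)) | (encode t).length ≤ 2 * (1 + N * (N + N)) + N ∧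
        ∀ a ∈ t.names, a ≤ 1 + N * (N + N)} := by
    intro t ht
    refine ⟨?_, ?_⟩
    · have h1 := length_encode_compress_le (h := Finset.univ) ht.wellFormed ht.separated
      have h2 := ht.size_le
      have h3 : t.label.card ≤ N := by simpa using Finset.card_le_univ t.label
      omega
    · rw [names_compress]
      exact ht.names_le
  have hinj : Set.InjOn (compress Finset.univ) {t : HopeTree N | StateTree t} := by
    intro t ht t' ht' he
    refine compress_inj ht.wellFormed ht'.wellFormed ?_ ?_ he
    · simp [edgeAnn, ht.deco]
    · simp [edgeAnn, ht'.deco]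
  exact ⟨Set.Finite.of_injOn hmap hinj h1, (Set.ncard_le_ncard_of_injOn _ hmap hinj h1).trans h2⟩

theorem stateTree_reachable (A : OmegaAut α N) {s : MarkedTree N (Finset (Fin N))}
    (hs : s ∈ (uniformDPW A).reachable) :
    StateTree s.tree ∧ s.e ≤ N ^ 2 + N + 2 ∧ s.f ≤ N ^ 2 + N + 2 := by
  obtain ⟨w, rfl⟩ := hs
  induction w using List.reverseRecOn with
  | nil =>
    refine ⟨⟨(settled_leaf _ _ _).wellFormed, (settled_leaf _ _ _).separated, rfl, ?_, 1, ?_⟩,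
      le_rfl, le_rfl⟩
    · simp [uniformDPW, size, sizeList]
    · simp [uniformDPW, names, namesList]
  | append_singleton w σ ih =>
    rw [List.foldl_append, List.foldl_cons, List.foldl_nil]
    generalize List.foldl (uniformDPW A).step (uniformDPW A).init w = s at ih
    refine ⟨?_, compact_e_le _ _ _, compact_f_le _ _ _⟩
    obtain ⟨hs, -⟩ := ih
    simp only [uniformDPW]
    have hwf : WellFormed (s.tree.advance A.δ σ) := hs.wellFormed.mapNodes _ fun S T hST =>
      Finset.biUnion_subset_biUnion_of_subset_left _ hST
    have hset := settled_recTree A ⟨s.tree.names, ∅⟩ hwf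
    have hnm : (s.tree.advance A.δ σ).names = s.tree.names := by
      simp [advance, names_mapNodes]
    have hn := recTree_names A (s.tree.advance A.δ σ) ⟨s.tree.names, ∅⟩ hnm.subset
    obtain ⟨M, hM⟩ := hs.names
    have hIcc := hn.1
    simp only [hM] at hIcc
    obtain ⟨M', hM'⟩ := hIcc.exists_Icc
    rw [← hM] at hM'
    have hdeco := deco_recTree A (s.tree.advance A.δ σ) ⟨s.tree.names, ∅⟩
    generalize recTree A (s.tree.advance A.δ σ) ⟨s.tree.names, ∅⟩ = r at *
    obtain ⟨g, hg⟩ := exists_compact_tree (N ^ 2 + N + 1) r.1 r.2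
    refine ⟨?_, ?_, ?_, ?_, _, names_compact hM' hn.2⟩
    · rw [hg]
      exact hset.wellFormed.mapNodes _ monotone_id
    · rw [hg]
      exact hset.separated.mapNodes _ _ (fun t => label_mapNodes _ _ t) (fun _ _ h => h)
    · rw [hg, deco_mapNodes, hdeco, advance, deco_mapNodes, hs.deco]
    · rw [hg, size_mapNodes]
      have h1 : r.1.label.card ≤ N := by simpa using Finset.card_le_univ r.1.label
      have h2 : r.1.deco.card ≤ N := by simpa using Finset.card_le_univ r.1.deco
      have h3 := STree.size_le hset.separated hset.reduced hset.wellFormed.nested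
        (hset.depth_le.trans (add_le_add h1 h2))
      exact h3.trans (Nat.add_le_add_left (Nat.mul_le_mul_right _ h1) 1)

theorem reachable_finite_and_ncard_le (A : OmegaAut α N) :
    (uniformDPW A).reachable.Finite ∧ (uniformDPW A).reachable.ncard ≤
      ((1 + N * (N + N) + 1) * (N + 1) + N + 2) ^ (2 * (1 + N * (N + N)) + N) *
        ((N ^ 2 + N + 3) * (N ^ 2 + N + 3)) := by
  obtain ⟨h1, h2⟩ := card_stateTree_le (N := N)
  obtain ⟨h3, h4⟩ := finite_markedTree h1 (N ^ 2 + N + 2)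
  have hsub : (uniformDPW A).reachable ⊆ {s : MarkedTree N (Finset (Fin N)) |
      s.tree ∈ {t | StateTree t} ∧ s.e ≤ N ^ 2 + N + 2 ∧ s.f ≤ N ^ 2 + N + 2} :=
    fun s hs => stateTree_reachable A hs
  exact ⟨h3.subset hsub, (Set.ncard_le_ncard hsub h3).trans
    (h4.trans (Nat.mul_le_mul_right _ h2))⟩

end Uniform
end OmegaDet

-- Finiteness of the Streett constructions and closure under permutations

namespace OmegaDet
namespace Safra

open STree

variable {α : Type} {N k : ℕ}

theorem size_le_of_settled {t : QHTree N k} (h : Settled Finset.univ t) :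
    size t ≤ 1 + N * (N + k) := by
  have h1 : t.leafStates.card ≤ N := by simpa using Finset.card_le_univ t.leafStates
  have h2 := h.depth_le
  rw [Finset.card_univ, Fintype.card_fin] at h2
  exact (STree.size_le h.separated h.reduced (nested_leafStates t)
    (h2.trans (Nat.add_le_add_right h1 k))).trans
    (Nat.add_le_add_left (Nat.mul_le_mul_right _ h1) 1)

theorem settled_next (A : NSW α N k) (fresh : Finset ℕ → ℕ) {t : QHTree N k} (σ : α)
    (ht : Annotated Finset.univ t) : Settled Finset.univ (next A fresh t σ).1 :=
  settled_recTree A fresh _ (ht.mapNodes _ _)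

theorem next_names (A : NSW α N k) (fresh : Finset ℕ → ℕ) (t : QHTree N k) (σ : α) :
    Extends fresh t.names (next A fresh t σ).2.used ∧
      (next A fresh t σ).1.names ⊆ (next A fresh t σ).2.used := by
  exact recTree_names A fresh (t.advance A.δ σ) Finset.univ ⟨t.names, ∅⟩
    (by simp [advance, names_mapNodes])

theorem finite_trees (N k s B : ℕ) :
    {t : QHTree N k | size t ≤ s ∧ ∀ a ∈ t.names, a ≤ B}.Finite := by
  classical
  have : Fintype (WithBot (Fin k)) := inferInstanceAs (Fintype (Option (Fin k)))
  refine (finite_encode B (s * (2 + N))).1.subset ?_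
  rintro t ⟨h1, h2⟩
  exact ⟨(length_encode_le t).trans (Nat.mul_le_mul_right _ h1), h2⟩

/-- The root's name `1` is listed separately because the interval of names is empty for `N = 0`. -/
theorem drw_reachable (A : NSW α N k) (V : Naming N k) {t : QHTree N k}
    (ht : t ∈ (drw A V).reachable) : Settled Finset.univ t ∧
      t.names ⊆ insert 1 (Finset.Icc 1 (2 * N * (k + 1))) := by
  obtain ⟨w, rfl⟩ := ht
  induction w using List.reverseRecOn with
  | nil => exact ⟨settled_leaf _ _ _ _, by simp [drw, initTree, names, namesList]⟩
  | append_singleton w σ ih =>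
    rw [List.foldl_append, List.foldl_cons, List.foldl_nil]
    generalize List.foldl (drw A V).step (drw A V).init w = t at ih
    obtain ⟨h1, h2⟩ := next_names A V.pick t σ
    refine ⟨settled_next A V.pick σ ih.1.annotated, (h2.trans (h1.subset_union V.pick_mem)).trans ?_⟩
    exact Finset.union_subset ih.2 (Finset.subset_insert _ _)

theorem drw_reachable_finite (A : NSW α N k) (V : Naming N k) :
    (drw A V).reachable.Finite := by
  refine (finite_trees N k (1 + N * (N + k)) (1 + 2 * N * (k + 1))).subset fun t ht => ?_
  obtain ⟨h1, h2⟩ := drw_reachable A V ht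
  refine ⟨size_le_of_settled h1, fun a ha => ?_⟩
  rcases Finset.mem_insert.1 (h2 ha) with rfl | h
  · omega
  · have := (Finset.mem_Icc.1 h).2
    omega

theorem piterman_reachable (A : NSW α N k) {s : MarkedTree N (WithBot (Fin k))}
    (hs : s ∈ (pitermanDPW A).reachable) :
    Annotated Finset.univ s.tree ∧ Separated leafStates s.tree ∧
      size s.tree ≤ 1 + N * (N + k) ∧ (∃ M, s.tree.names = Finset.Icc 1 M) ∧
      s.e ≤ N * (k + 1) + 1 ∧ s.f ≤ N * (k + 1) + 1 := by
  obtain ⟨w, rfl⟩ := hs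
  induction w using List.reverseRecOn with
  | nil =>
    have h : Settled Finset.univ (initTree A) := settled_leaf _ _ _ _
    exact ⟨h.annotated, h.separated, size_le_of_settled h, ⟨1, rfl⟩, le_rfl, le_rfl⟩
  | append_singleton w σ ih =>
    rw [List.foldl_append, List.foldl_cons, List.foldl_nil]
    generalize List.foldl (pitermanDPW A).step (pitermanDPW A).init w = s at ih
    obtain ⟨ha, -, -, ⟨M, hM⟩, -⟩ := ih
    obtain ⟨h1, h2⟩ := next_names A nextName s.tree σ
    have hset := settled_next A nextName σ ha
    rw [hM] at h1
    obtain ⟨M', hM'⟩ := h1.exists_Icc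
    simp only [pitermanDPW]
    generalize next A nextName s.tree σ = r at *
    obtain ⟨g, hg⟩ := exists_compact_tree (N * (k + 1)) r.1 r.2
    refine ⟨?_, ?_, ?_, ⟨_, names_compact hM' h2⟩, compact_e_le _ _ _, compact_f_le _ _ _⟩
    · rw [hg]
      exact hset.annotated.mapNodes _ _
    · rw [hg]
      exact hset.separated.mapNodes _ _ (fun t => leafStates_mapNodes _ _ (fun _ _ => rfl) rfl t)
        (fun _ _ h => h)
    · rw [hg, size_mapNodes]
      exact size_le_of_settled hset

theorem piterman_reachable_finite (A : NSW α N k) : (pitermanDPW A).reachable.Finite := by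
  refine (finite_markedTree (finite_trees N k (1 + N * (N + k)) (1 + N * (N + k)))
    (N * (k + 1) + 1)).1.subset fun s hs => ?_
  obtain ⟨-, -, h1, ⟨M, hM⟩, h2, h3⟩ := piterman_reachable A hs
  refine ⟨⟨h1, fun a ha => ?_⟩, h2, h3⟩
  have h4 := card_names_le_size s.tree
  rw [hM, Nat.card_Icc] at h4
  rw [hM, Finset.mem_Icc] at ha
  omega

theorem permClosed_drw (A : NSW α N k) (V : Naming N k)
    (hA : ∀ π : Equiv.Perm (Fin N), ∃ σ, ∀ q, A.δ q σ = {π q}) :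
    PermClosed A (drw A V).reachable where
  init := ⟨initTree A, ⟨[], rfl⟩, (settled_leaf Finset.univ _ _ _).separated, fun _ hq => .leaf hq⟩
  step := by
    intro t ht hs π
    obtain ⟨σ, hσ⟩ := hA π
    have h := settled_next A V.pick σ (drw_reachable A V ht).1.annotated
    obtain ⟨w, rfl⟩ := ht
    refine ⟨_, ⟨w ++ [σ], by rw [List.foldl_append]; rfl⟩, h.separated, ?_⟩
    exact fun q p p' hq hF hp => at_next π hσ hs hF hq hp

/-- Compaction changes names only, which paths ignore. Passing to the image under `MarkedTree.tree`
cannot increase the number of states, so a lower bound for the image is enough. -/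
theorem permClosed_piterman (A : NSW α N k)
    (hA : ∀ π : Equiv.Perm (Fin N), ∃ σ, ∀ q, A.δ q σ = {π q}) :
    PermClosed A (MarkedTree.tree '' (pitermanDPW A).reachable) where
  init := ⟨initTree A, ⟨_, ⟨[], rfl⟩, rfl⟩, (settled_leaf Finset.univ _ _ _).separated,
    fun _ hq => .leaf hq⟩
  step := by
    rintro _ ⟨s, hs, rfl⟩ hsep π
    obtain ⟨σ, hσ⟩ := hA π
    have hs' : (pitermanDPW A).step s σ ∈ (pitermanDPW A).reachable := by
      obtain ⟨w, rfl⟩ := hs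
      exact ⟨w ++ [σ], by rw [List.foldl_append]; rfl⟩
    refine ⟨_, ⟨_, hs', rfl⟩, (piterman_reachable A hs').2.1, fun q p p' hq hF hp => ?_⟩
    obtain ⟨g, hg⟩ := exists_compact_tree (N * (k + 1)) (next A nextName s.tree σ).1
      (next A nextName s.tree σ).2
    simp only [pitermanDPW]
    rw [hg]
    exact (at_next π hσ hsep hF hq hp).mapNodes _ _ fun _ h => h

end Safra

/-! ### The family of automata -/

/-- The automaton over the alphabet of all transition maps. The initial states are those below
`n`. The sets `E j` consist of the states `n + l` with `1 + l * 2 ^ (n / 2) ≤ j`, and the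
sets `F j` of the states `2 * n + b` such that `b` is a position of a binary digit `1` of `j`. -/
noncomputable def family (n : ℕ) :
    NSW (Fin (Fintype.card (Fin (3 * n + 1) → Finset (Fin (3 * n + 1))))) (3 * n + 1)
      (2 ^ n + 1) where
  init := Finset.univ.filter fun q => q.val < n
  δ := fun q σ => (Fintype.equivFin (Fin (3 * n + 1) → Finset (Fin (3 * n + 1)))).symm σ q
  E := fun j => Finset.univ.filter fun q =>
    n ≤ q.val ∧ q.val < 2 * n ∧ 1 + (q.val - n) * 2 ^ (n / 2) ≤ j.val
  F := fun j => Finset.univ.filter fun q => 2 * n ≤ q.val ∧ j.val.testBit (q.val - 2 * n)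

/-- The index `j ≤ 2 ^ n` has at most `n + 1` binary digits, one for each of the states from `2 * n`
on, so `F j` determines `j`. -/
theorem family_injective (n : ℕ) :
    Function.Injective fun j => ((family n).E j, (family n).F j) := by
  intro i j hij
  have hF : (family n).F i = (family n).F j := (Prod.mk.inj hij).2
  refine Fin.ext (Nat.eq_of_testBit_eq fun b => ?_)
  by_cases hb : b ≤ n
  · have := Finset.ext_iff.1 hF ⟨2 * n + b, by omega⟩
    simp only [family, Finset.mem_filter, Finset.mem_univ, true_and, Nat.le_add_right,
      Nat.add_sub_cancel_left] at this
    exact Bool.eq_iff_iff.2 this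
  · have h1 : (2 : ℕ) ^ n + 1 ≤ 2 ^ b := by
      have : (2 : ℕ) ^ n < 2 ^ b := Nat.pow_lt_pow_right (by norm_num) (by omega)
      omega
    rw [Nat.testBit_lt_two_pow (i.isLt.trans_le h1), Nat.testBit_lt_two_pow (j.isLt.trans_le h1)]

theorem family_perm (n : ℕ) (π : Equiv.Perm (Fin (3 * n + 1))) :
    ∃ σ, ∀ q, (family n).δ q σ = {π q} :=
  ⟨Fintype.equivFin _ fun q => {π q}, fun q => by simp [family]⟩

/-- The counters of the automata of the family. -/
def familyCounters (n : ℕ) : Safra.Counters (family n) n fun l => 1 + l * 2 ^ (n / 2) where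
  r := fun i => ⟨i.val, by omega⟩
  s := fun l => Fin.ofNat (3 * n + 1) (n + l)
  r_inj := fun i j h => Fin.ext (Fin.mk.inj h)
  r_ne_s := fun i l hl h => by
    have h1 := congrArg Fin.val h
    simp only [Fin.ofNat, Nat.mod_eq_of_lt (show n + l < 3 * n + 1 by omega)] at h1
    omega
  r_init := fun i => by simp [family]
  r_E := fun i j => by simp [family]
  r_F := fun i j => by
    simp only [family, Finset.mem_filter, not_and]
    omega
  s_E := fun l hl j => by
    simp only [family, Finset.mem_filter, Finset.mem_univ, true_and, Fin.ofNat,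
      Nat.mod_eq_of_lt (show n + l < 3 * n + 1 by omega), Nat.add_sub_cancel_left]
    exact ⟨fun h => h.2.2, fun h => ⟨by omega, by omega, h⟩⟩
  s_F := fun l hl j => by
    simp only [family, Finset.mem_filter, Finset.mem_univ, true_and, Fin.ofNat,
      Nat.mod_eq_of_lt (show n + l < 3 * n + 1 by omega), not_and]
    omega

theorem mul_two_pow_half_lt {n : ℕ} (hn : 5 ≤ n) : n * 2 ^ (n / 2) < 2 ^ n := by
  have h : ∀ m : ℕ, 2 * (m + 3) < 2 ^ (m + 3) := by
    intro m
    induction m with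
    | zero => norm_num
    | succ m ih =>
      rw [show m + 1 + 3 = m + 3 + 1 by ring, pow_succ]
      omega
  -- With `m = n - n / 2 ≥ 3`, the claim follows from `n ≤ 2 * m < 2 ^ m`.
  have h1 := h (n - n / 2 - 3)
  rw [Nat.sub_add_cancel (by omega)] at h1
  calc n * 2 ^ (n / 2) < 2 ^ (n - n / 2) * 2 ^ (n / 2) :=
        Nat.mul_lt_mul_of_pos_right (by omega) (by positivity)
    _ = 2 ^ n := by rw [← pow_add, Nat.sub_add_cancel (by omega)]

theorem two_rpow_le_of_pow_le {n X : ℕ} (hn : 2 ≤ n) (h : (2 ^ (n / 2)) ^ (n * n) ≤ X) :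
    (2 : ℝ) ^ ((1 / 4 : ℝ) * (n : ℝ) ^ 3) ≤ (X : ℝ) := by
  have h1 : ((2 : ℝ) ^ (((n / 2) * (n * n) : ℕ) : ℝ)) ≤ (X : ℝ) := by
    rw [Real.rpow_natCast, pow_mul]
    exact_mod_cast h
  refine le_trans (Real.rpow_le_rpow_of_exponent_le (by norm_num) ?_) h1
  -- The constant `1 / 4` absorbs the rounding in `n / 2`.
  have h2 : n ≤ 4 * (n / 2) := by omega
  have h3 : (n : ℝ) ≤ 4 * ((n / 2 : ℕ) : ℝ) := by exact_mod_cast h2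
  push_cast
  have h4 : (0 : ℝ) ≤ (n : ℝ) * n := by positivity
  have h5 := mul_le_mul_of_nonneg_right h3 h4
  nlinarith [h5]

/-- The base is at most `n ^ 7`, the exponent at most `112 * n ^ 2`, the factor for `e` and `f` at
most `n ^ 9`; and `7 * 112 + 9 = 793`. -/
theorem uniform_bound_le {n N : ℕ} (hn : 16 ≤ n) (hN : N = 3 * n + 1) :
    ((1 + N * (N + N) + 1) * (N + 1) + N + 2) ^ (2 * (1 + N * (N + N)) + N) *
      ((N ^ 2 + N + 3) * (N ^ 2 + N + 3)) ≤ n ^ (793 * n ^ 2) := by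
  have h1 : 1 ≤ N := by omega
  have h2 : N ≤ n ^ 2 := by nlinarith
  have h3 : N ≤ 4 * n := by omega
  have h4 : N ≤ N ^ 2 := by nlinarith
  have h5 : N ^ 2 ≤ N ^ 3 := Nat.pow_le_pow_right h1 (by norm_num)
  have hX : (1 + N * (N + N) + 1) * (N + 1) + N + 2 ≤ n ^ 7 :=
    calc (1 + N * (N + N) + 1) * (N + 1) + N + 2
        = 2 * N ^ 3 + 2 * N ^ 2 + 3 * N + 4 := by ring
      _ ≤ 16 * N ^ 3 := by omega
      _ ≤ n * (n ^ 2) ^ 3 := Nat.mul_le_mul hn (Nat.pow_le_pow_left h2 3)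
      _ = n ^ 7 := by ring
  have hL : 2 * (1 + N * (N + N)) + N ≤ 112 * n ^ 2 :=
    calc 2 * (1 + N * (N + N)) + N = 4 * N ^ 2 + N + 2 := by ring
      _ ≤ 7 * N ^ 2 := by omega
      _ ≤ 7 * (4 * n) ^ 2 := Nat.mul_le_mul_left _ (Nat.pow_le_pow_left h3 2)
      _ = 112 * n ^ 2 := by ring
  have hM : (N ^ 2 + N + 3) * (N ^ 2 + N + 3) ≤ n ^ 9 :=
    calc (N ^ 2 + N + 3) * (N ^ 2 + N + 3) ≤ (5 * N ^ 2) * (5 * N ^ 2) :=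
          Nat.mul_le_mul (by omega) (by omega)
      _ = 25 * (N * N ^ 3) := by ring
      _ ≤ n ^ 9 := by
        have h6 : N * N ^ 3 ≤ (4 * n) * (n ^ 2) ^ 3 :=
          Nat.mul_le_mul h3 (Nat.pow_le_pow_left h2 3)
        have h7 : 100 ≤ n ^ 2 := by nlinarith
        calc 25 * (N * N ^ 3) ≤ 25 * ((4 * n) * (n ^ 2) ^ 3) := Nat.mul_le_mul_left _ h6
          _ = 100 * n ^ 7 := by ring
          _ ≤ n ^ 2 * n ^ 7 := Nat.mul_le_mul_right _ h7
          _ = n ^ 9 := by ring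
  calc ((1 + N * (N + N) + 1) * (N + 1) + N + 2) ^ (2 * (1 + N * (N + N)) + N) *
      ((N ^ 2 + N + 3) * (N ^ 2 + N + 3))
      ≤ (n ^ 7) ^ (112 * n ^ 2) * n ^ 9 := Nat.mul_le_mul
        ((Nat.pow_le_pow_left hX _).trans (Nat.pow_le_pow_right (by positivity) hL)) hM
    _ = n ^ (7 * (112 * n ^ 2) + 9) := by rw [← pow_mul, ← pow_add]
    _ ≤ n ^ (793 * n ^ 2) := Nat.pow_le_pow_right (by omega) (by nlinarith)

theorem le_two_rpow {n X : ℕ} (hn : 2 ≤ n) (h : X ≤ n ^ (793 * n ^ 2)) :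
    (X : ℝ) ≤ (2 : ℝ) ^ ((1600 : ℝ) * (n : ℝ) ^ 2 * Real.log n) := by
  have hn0 : (0 : ℝ) < n := by exact_mod_cast (by omega : 0 < n)
  have h1 : (X : ℝ) ≤ (n : ℝ) ^ (793 * n ^ 2) := by exact_mod_cast h
  refine h1.trans ?_
  rw [← Real.rpow_natCast, Real.rpow_def_of_pos hn0, Real.rpow_def_of_pos (by norm_num)]
  refine Real.exp_le_exp.2 ?_
  have hlog : 0 ≤ Real.log n := Real.log_natCast_nonneg n
  -- In base `2` the exponent is divided by `log 2`, so `1600` suffices because `793 ≤ 1600 / 2`.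
  have h2 : (0.5 : ℝ) ≤ Real.log 2 := by linarith [Real.log_two_gt_d9]
  have h3 : 0 ≤ Real.log n * (n : ℝ) ^ 2 := by positivity
  push_cast
  nlinarith [mul_le_mul_of_nonneg_right h2 h3]

end OmegaDet

-- The theorem

theorem mainTheorem3 :
    ∃ (a : ℕ → ℕ) (A : (n : ℕ) → OmegaDet.NSW (Fin (a n)) (3 * n + 1) (2 ^ n + 1)),
      (∀ n, Function.Injective fun j => ((A n).E j, (A n).F j)) ∧
      ∃ (c C : ℝ) (n₀ : ℕ), 0 < c ∧ 0 < C ∧ ∀ n ≥ n₀,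
        (∀ V : OmegaDet.Safra.Naming (3 * n + 1) (2 ^ n + 1),
          (OmegaDet.Safra.drw (A n) V).reachable.Finite ∧
          (2 : ℝ) ^ (c * (n : ℝ) ^ 3) ≤ ((OmegaDet.Safra.drw (A n) V).reachable.ncard : ℝ)) ∧
        ((OmegaDet.pitermanDPW (A n)).reachable.Finite ∧
          (2 : ℝ) ^ (c * (n : ℝ) ^ 3) ≤ ((OmegaDet.pitermanDPW (A n)).reachable.ncard : ℝ)) ∧
        ((OmegaDet.uniformDPW (A n).toOmegaAut).reachable.Finite ∧
          ((OmegaDet.uniformDPW (A n).toOmegaAut).reachable.ncard : ℝ)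
            ≤ (2 : ℝ) ^ (C * (n : ℝ) ^ 2 * Real.log n)) := by
  refine ⟨_, OmegaDet.family, OmegaDet.family_injective, 1 / 4, 1600, 16, by norm_num,
    by norm_num, fun n hn => ⟨fun V => ?_, ?_, ?_⟩⟩
  · have hfin := OmegaDet.Safra.drw_reachable_finite (OmegaDet.family n) V
    have hw := OmegaDet.mul_two_pow_half_lt (n := n) (by omega)
    exact ⟨hfin, OmegaDet.two_rpow_le_of_pow_le (by omega)
      (OmegaDet.Safra.pow_le_ncard (OmegaDet.familyCounters n)
        (OmegaDet.Safra.permClosed_drw _ V (OmegaDet.family_perm n)) (by omega) hfin)⟩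
  · have hfin := OmegaDet.Safra.piterman_reachable_finite (OmegaDet.family n)
    have hw := OmegaDet.mul_two_pow_half_lt (n := n) (by omega)
    exact ⟨hfin, OmegaDet.two_rpow_le_of_pow_le (by omega)
      ((OmegaDet.Safra.pow_le_ncard (OmegaDet.familyCounters n)
        (OmegaDet.Safra.permClosed_piterman _ (OmegaDet.family_perm n)) (by omega)
        (hfin.image _)).trans (Set.ncard_image_le hfin))⟩
  · obtain ⟨h1, h2⟩ := OmegaDet.Uniform.reachable_finite_and_ncard_le
      (OmegaDet.family n).toOmegaAut
    exact ⟨h1, OmegaDet.le_two_rpow (by omega)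
      (h2.trans (OmegaDet.uniform_bound_le hn rfl))⟩
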